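/- **Formulas and sequents.** Formulas are built from propositional variables $p_0,p_1,\dots$ and $\bot$ by means of $\to$, $\Box$ and $\Box^+$. A sequent $\Sigma;\Gamma\Rightarrow\Delta$ consists of an arbitrary set $\Sigma$ of formulas and finite multisets $\Gamma,\Delta$ of formulas. For a multiset $\Gamma=A_1,\dots,A_n$ put $\Box\Gamma=\Box A_1,\dots,\Box A_n$ and $\Box^+\Gamma=\Box^+A_1,\dots,\Box^+A_n$. **Calculus.** The initial sequents of $\mathsf S+\mathsf{cut}$ are $\Sigma;\Gamma,p\Rightarrow p,\Delta$ ($p$ a variable) and $\Sigma;\Gamma,\bot\Rightarrow\Delta$; its rules are (premises listed from left to right) - $(\to_L)$: from $\Sigma;\Gamma,B\Rightarrow\Delta$ and $\Sigma;\Gamma\Rightarrow A,\Delta$ infer $\Sigma;\Gamma,A\to B\Rightarrow\Delta$; - $(\to_R)$: from $\Sigma;\Gamma,A\Rightarrow B,\Delta$ infer $\Sigma;\Gamma\Rightarrow A\to B,\Delta$; - $(\Box)$: from $\Sigma;\Sigma_0,\Lambda,\Pi,\Box^+\Pi\Rightarrow A$ infer $\Sigma;\Phi,\Box\Lambda,\Box^+\Pi\Rightarrow\Box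 A,\Psi$; - $(\Box^+)$: from $\Sigma;\Sigma_0,\Lambda,\Pi,\Box^+\Pi\Rightarrow A$ and $\Sigma;\Sigma_0,\Lambda,\Pi,\Box^+\Pi\Rightarrow\Box^+A$ infer $\Sigma;\Phi,\Box\Lambda,\Box^+\Pi\Rightarrow\Box^+A,\Psi$; - $(\mathsf{cut})$: from $\Sigma;\Gamma\Rightarrow A,\Delta$ and $\Sigma;\Gamma,A\Rightarrow\Delta$ infer $\Sigma;\Gamma\Rightarrow\Delta$, where $\Sigma_0$ is a finite subset of $\Sigma$. The rules $(\Box)$ and $(\Box^+)$ are called modal, with principal formulas $\Box A$ and $\Box^+A$. An application of a modal rule is *slim* if $\Lambda$ and $\Pi$ can be taken without repetitions. **$\infty$-proofs.** An $\infty$-proof is a possibly infinite tree marked by sequents, constructed according to the rules of $\mathsf S+\mathsf{cut}$, whose leaves are initial sequents and in which every infinite branch has a tail such that: (a) all applications of $(\Box^+)$ in the tail have the same principal formula; (b) the tail passes through the right premise of $(\Box^+)$ infinitely many times; (c) it does not pass through the left premise of $(\Box^+)$; (d) it contains no application of $(\Box)$. Let $\mathsf P$ be the set of all $\infty$-proofs.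 **Annotations and fragments.** An annotation $s$ is a formula or the sign $\circ$. For $\pi\in\mathsf P$ with root $\Sigma;\Gamma\Rightarrow\Delta$, let $\mathit{Ann}(\pi)=\{\circ\}\cup\{A\mid\Box^+A\in\Delta\}$. For $s\in\mathit{Ann}(\pi)$, the annotated tree $\pi^s$ is obtained by annotating the root with $s$ and proceeding upwards: the premise of $(\Box)$ and the left premise of $(\Box^+)$ get $\circ$, the right premise of $(\Box^+)$ with principal formula $\Box^+A$ gets $A$, and premises of all other rules inherit the annotation of the conclusion. An application of $(\Box^+)$ in $\pi^s$ has *level* $n>0$ if the path from the root to its right premise goes through no premise of $(\Box)$ and no left premise of $(\Box^+)$, all annotations on this path are equal to $s$, and it passes through exactly $n$ applications of $(\Box^+)$ (the given one included). For $n>0$, the *$n$-fragment* of $\pi^s$ is obtained by removing all right premises of applications of $(\Box^+)$ of level $n$ together with their descendants (the rule applied at each remaining node is kept as part of the fragment). For $n>0$: $\pi\sim^s_n\tau$ means that $s\in\mathit{Ann}(\pi)\cap\mathit{Ann}(\tau)$ and the $n$-fragments of $\pi^s$ and $\tau^s$ coincide; $\pi\in\mathsf{CF}_n(s)$ means that $s\in\mathit{Ann}(\pi)$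 and there is no application of $(\mathsf{cut})$ in the $n$-fragment of $\pi^s$; $\pi\in\mathsf{SM}_n(s)$ means that $s\in\mathit{Ann}(\pi)$ and every application of a modal rule whose conclusion belongs to the $n$-fragment of $\pi^s$ is slim. For $n=0$ each of these notions requires only that $s$ belongs to $\mathit{Ann}$ of the $\infty$-proofs involved. **Operations.** A binary operation on $\mathsf P$ is a function $\mathsf a\colon\mathsf P\times\mathsf P\to\mathsf P$ such that $\mathit{Ann}(\pi)\cap\mathit{Ann}(\tau)\subset\mathit{Ann}(\mathsf a(\pi,\tau))$ for all $\pi,\tau$. It is - *$A$-removing* if, whenever $\pi$ is an $\infty$-proof of $\Sigma;\Gamma\Rightarrow A,\Delta$ and $\tau$ is an $\infty$-proof of $\Sigma;\Gamma,A\Rightarrow\Delta$, $\mathsf a(\pi,\tau)$ is an $\infty$-proof of $\Sigma;\Gamma\Rightarrow\Delta$; - *non-expansive* if $\pi\sim^s_i\pi'$ and $\tau\sim^s_i\tau'$ imply $\mathsf a(\pi,\tau)\sim^s_i\mathsf a(\pi',\tau')$, for all $s$ and $i\in\mathbb N$; - *non-pollutive* if $\pi,\tau\in\mathsf{CF}_i(s)$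 implies $\mathsf a(\pi,\tau)\in\mathsf{CF}_i(s)$, for all $s$ and $i\in\mathbb N$; - *non-fattening* if $\pi,\tau\in\mathsf{SM}_i(s)$ implies $\mathsf a(\pi,\tau)\in\mathsf{SM}_i(s)$, for all $s$ and $i\in\mathbb N$. **Proposition.** For any formula $A$, there exists a non-expansive, non-pollutive and non-fattening $A$-removing operation $\mathsf{re}_A$ on $\mathsf P$. -/

import Mathlib

/-- Formulas of the bimodal logic of transitive closure. -/
inductive Formula : Type
  | var : ℕ → Formula
  | bot : Formula
  | imp : Formula → Formula → Formula
  | box : Formula → Formula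
  | boxPlus : Formula → Formula

/-- A sequent `ctx ; ant ⇒ suc`: `ctx` is an arbitrary set of formulas, `ant` and `suc` are
finite multisets of formulas. -/
@[ext]
structure Sequent : Type where
  ctx : Set Formula
  ant : Multiset Formula
  suc : Multiset Formula

/-- Names of the rules, with the principal formula (the cut formula in the case of `cut`).
`impL A B` and `impR A B` have the principal formula `A → B`, `box A` has the principal formula
`□ A`, and `boxPlus A` has the principal formula `□⁺ A`. Given a conclusion and its list of
premises, the name of the rule is uniquely determined. -/
inductive Rule : Type
  | ax : Rule
  | impL : Formula → Formula → Rule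
  | impR : Formula → Formula → Rule
  | box : Formula → Rule
  | boxPlus : Formula → Rule
  | cut : Formula → Rule

/-- The rules `□` and `□⁺` are the modal rules. -/
def Rule.IsModal : Rule → Prop
  | .box _ => True
  | .boxPlus _ => True
  | _ => False

/-- `ModalStep S Γ Θ L P`: for some multiset `Φ` and some finite subset `S₀` of `S`, the
antecedent `Γ` of the conclusion of a modal rule is `Φ, □ L, □⁺ P`, and the antecedent `Θ` of its
premises is `S₀, L, P, □⁺ P`. -/
def ModalStep (S : Set Formula) (Γ Θ L P : Multiset Formula) : Prop :=
  ∃ (Φ : Multiset Formula) (S₀ : Finset Formula), (↑S₀ : Set Formula) ⊆ S ∧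
    Γ = Φ + L.map Formula.box + P.map Formula.boxPlus ∧
    Θ = S₀.val + L + P + P.map Formula.boxPlus

/-- `Inference c r ps`: from the list of premises `ps` (from left to right) one obtains the
conclusion `c` by one application of the rule `r` of the calculus with cut. -/
inductive Inference : Sequent → Rule → List Sequent → Prop
  | axVar (S : Set Formula) (Γ Δ : Multiset Formula) (p : ℕ) :
      Inference ⟨S, Formula.var p ::ₘ Γ, Formula.var p ::ₘ Δ⟩ Rule.ax []
  | axBot (S : Set Formula) (Γ Δ : Multiset Formula) :
      Inference ⟨S, Formula.bot ::ₘ Γ, Δ⟩ Rule.ax []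
  | impL (S : Set Formula) (Γ Δ : Multiset Formula) (A B : Formula) :
      Inference ⟨S, Formula.imp A B ::ₘ Γ, Δ⟩ (Rule.impL A B)
        [⟨S, B ::ₘ Γ, Δ⟩, ⟨S, Γ, A ::ₘ Δ⟩]
  | impR (S : Set Formula) (Γ Δ : Multiset Formula) (A B : Formula) :
      Inference ⟨S, Γ, Formula.imp A B ::ₘ Δ⟩ (Rule.impR A B) [⟨S, A ::ₘ Γ, B ::ₘ Δ⟩]
  | box (S : Set Formula) (Γ Θ L P Ψ : Multiset Formula) (A : Formula)
      (h : ModalStep S Γ Θ L P) :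
      Inference ⟨S, Γ, Formula.box A ::ₘ Ψ⟩ (Rule.box A) [⟨S, Θ, {A}⟩]
  | boxPlus (S : Set Formula) (Γ Θ L P Ψ : Multiset Formula) (A : Formula)
      (h : ModalStep S Γ Θ L P) :
      Inference ⟨S, Γ, Formula.boxPlus A ::ₘ Ψ⟩ (Rule.boxPlus A)
        [⟨S, Θ, {A}⟩, ⟨S, Θ, {Formula.boxPlus A}⟩]
  | cut (S : Set Formula) (Γ Δ : Multiset Formula) (A : Formula) :
      Inference ⟨S, Γ, Δ⟩ (Rule.cut A) [⟨S, Γ, A ::ₘ Δ⟩, ⟨S, A ::ₘ Γ, Δ⟩]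

/-- A (possibly infinite) binary tree whose nodes are marked by a sequent and the name of the rule
applied there. A node is the list of steps that lead to it from the root: `false` goes to the left
(or the only) premise and `true` to the right premise. The value `none` means: no such node. -/
abbrev SeqTree : Type := List Bool → Option (Sequent × Rule)

/-- The rule applied at a node. -/
def SeqTree.ruleAt (t : SeqTree) (w : List Bool) : Option Rule := (t w).map Prod.snd

/-- The sequent at a node. -/
def SeqTree.seqAt (t : SeqTree) (w : List Bool) : Option Sequent := (t w).map Prod.fst

/-- The first `n` steps of an infinite path. -/
def pathPrefix (f : ℕ → Bool) (n : ℕ) : List Bool := (List.range n).map f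

/-- Conditions (a)-(d) on the tail, from step `N` on, of the infinite branch `f`, with the
common principal formula `□⁺ A`. -/
def GoodTail (t : SeqTree) (f : ℕ → Bool) (N : ℕ) (A : Formula) : Prop :=
  (∀ n ≥ N, ∀ B, t.ruleAt (pathPrefix f n) = some (Rule.boxPlus B) → B = A) ∧
  (∀ m, ∃ n ≥ m, ∃ B, t.ruleAt (pathPrefix f n) = some (Rule.boxPlus B) ∧ f n = true) ∧
  (∀ n ≥ N, ∀ B, t.ruleAt (pathPrefix f n) = some (Rule.boxPlus B) → f n ≠ false) ∧
  (∀ n ≥ N, ∀ B, t.ruleAt (pathPrefix f n) ≠ some (Rule.box B))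

/-- An `∞`-proof of the calculus with cut. -/
@[ext]
structure InfProof : Type where
  tree : SeqTree
  root_mem : (tree []).isSome
  closed : ∀ w b, tree w = none → tree (w ++ [b]) = none
  step : ∀ w c r, tree w = some (c, r) →
    ∃ ps : List Sequent, Inference c r ps ∧ ∀ b : Bool, tree.seqAt (w ++ [b]) = ps[b.toNat]?
  branch : ∀ f : ℕ → Bool, (∀ n, (tree (pathPrefix f n)).isSome) → ∃ N A, GoodTail tree f N A

/-- The sequent at the root of an `∞`-proof. -/
def InfProof.root (π : InfProof) : Sequent := ((π.tree []).get π.root_mem).1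

/-- Annotations: `none` is the auxiliary sign `∘`. -/
abbrev Annot : Type := Option Formula

/-- The set of all possible annotations of a sequent. -/
def Sequent.Ann (c : Sequent) : Set Annot :=
  {s | ∀ A, s = some A → Formula.boxPlus A ∈ c.suc}

/-- The set of all possible annotations of the root of an `∞`-proof. -/
def InfProof.Ann (π : InfProof) : Set Annot := π.root.Ann

/-- The annotation of a premise (right if `b` is `true`, left or only if `b` is `false`) in the
annotated version of a rule, where `s` is the annotation of the conclusion. -/
def Rule.next (s : Annot) (b : Bool) : Rule → Annot
  | .box _ => none
  | .boxPlus A => if b then some A else none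
  | _ => s

/-- The annotation of a node after the root has been annotated with `s` and all rules have been
replaced, upwards from the root, with their annotated versions. -/
def annAt : SeqTree → Annot → List Bool → Annot
  | _, s, [] => s
  | t, s, b :: w =>
    annAt (fun v => t (b :: v)) (((t.ruleAt []).map (Rule.next s b)).getD s) w

/-- The node `w` of the tree annotated from `s` is `≈`-equivalent to the root: the path between
them does not go through the premise of a rule `□` or the left premise of a rule `□⁺`, and all
sequents on it have the same annotation. -/
def EquivRoot (t : SeqTree) (s : Annot) (w : List Bool) : Prop :=
  ∀ v b, (v ++ [b]) <+: w →
    (∀ A, t.ruleAt v ≠ some (Rule.box A)) ∧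
    (∀ A, t.ruleAt v = some (Rule.boxPlus A) → b ≠ false) ∧
    annAt t s (v ++ [b]) = s

/-- The number of applications of the rule `□⁺` that the path from the root to `w` passes
through. -/
noncomputable def boxPlusCount (t : SeqTree) (w : List Bool) : ℕ :=
  Set.ncard {v : List Bool | v <+: w ∧ v ≠ w ∧ ∃ A, t.ruleAt v = some (Rule.boxPlus A)}

/-- `w` is the right premise of an application of the rule `□⁺` of level `n`. -/
def IsLevelPremise (t : SeqTree) (s : Annot) (n : ℕ) (w : List Bool) : Prop :=
  (∃ v A, w = v ++ [true] ∧ t.ruleAt v = some (Rule.boxPlus A)) ∧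
    EquivRoot t s w ∧ boxPlusCount t w = n

/-- `w` is a node of the `n`-fragment: it is a node of the tree, and it is neither a right premise
of a rule `□⁺` of level `n` nor a descendant of such a premise. -/
def InFragment (t : SeqTree) (s : Annot) (n : ℕ) (w : List Bool) : Prop :=
  (t w).isSome ∧ ∀ v, v <+: w → ¬ IsLevelPremise t s n v

open Classical in
/-- The `n`-fragment of the annotated tree, with annotations, sequents and rule names. -/
noncomputable def fragment (t : SeqTree) (s : Annot) (n : ℕ) :
    List Bool → Option (Annot × Sequent × Rule) :=
  fun w => if InFragment t s n w then (t w).map (fun l => (annAt t s w, l)) else none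

/-- The relation `π ∼ⁿₛ τ` on the set of `∞`-proofs that can be annotated with `s`. -/
def Sim (s : Annot) (n : ℕ) (π τ : InfProof) : Prop :=
  s ∈ π.Ann ∧ s ∈ τ.Ann ∧ (0 < n → fragment π.tree s n = fragment τ.tree s n)

/-- The set `CFₙ(s)`. -/
def CF (n : ℕ) (s : Annot) : Set InfProof :=
  {π | s ∈ π.Ann ∧ (0 < n → ∀ w, InFragment π.tree s n w →
    ∀ A, π.tree.ruleAt w ≠ some (Rule.cut A))}

/-- If a modal rule is applied at the node `w`, then this application is slim, i.e. the multisets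
of formulas that are boxed in its conclusion can be taken without repetitions. -/
def SlimAt (t : SeqTree) (w : List Bool) : Prop :=
  ∀ c r p, t w = some (c, r) → r.IsModal → t.seqAt (w ++ [false]) = some p →
    ∃ L P : Multiset Formula, L.Nodup ∧ P.Nodup ∧ ModalStep c.ctx c.ant p.ant L P

/-- The set `SMₙ(s)`. -/
def SM (n : ℕ) (s : Annot) : Set InfProof :=
  {π | s ∈ π.Ann ∧ (0 < n → ∀ w, InFragment π.tree s n w → SlimAt π.tree w)}

/-- Binary operations on `∞`-proofs are the functions that preserve annotations. -/
def IsBinaryOperation (a : InfProof → InfProof → InfProof) : Prop :=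
  ∀ π τ, π.Ann ∩ τ.Ann ⊆ (a π τ).Ann

/-- `(π, τ)` is a cut pair with the cut formula `A` and the cut result `c`. -/
def IsCutPair (A : Formula) (c : Sequent) (π τ : InfProof) : Prop :=
  π.root = ⟨c.ctx, c.ant, A ::ₘ c.suc⟩ ∧ τ.root = ⟨c.ctx, A ::ₘ c.ant, c.suc⟩

/-- `A`-removing operations. -/
def IsRemoving (A : Formula) (a : InfProof → InfProof → InfProof) : Prop :=
  IsBinaryOperation a ∧ ∀ c π τ, IsCutPair A c π τ → (a π τ).root = c

/-- Non-expansive operations. -/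
def NonExpansive (a : InfProof → InfProof → InfProof) : Prop :=
  ∀ (s : Annot) (i : ℕ) (π τ π' τ' : InfProof),
    Sim s i π π' → Sim s i τ τ' → Sim s i (a π τ) (a π' τ')

/-- Non-pollutive operations. -/
def NonPollutive (a : InfProof → InfProof → InfProof) : Prop :=
  ∀ (s : Annot) (i : ℕ) (π τ : InfProof), π ∈ CF i s → τ ∈ CF i s → a π τ ∈ CF i s

/-- Non-fattening operations. -/
def NonFattening (a : InfProof → InfProof → InfProof) : Prop :=
  ∀ (s : Annot) (i : ℕ) (π τ : InfProof), π ∈ SM i s → τ ∈ SM i s → a π τ ∈ SM i s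

/-!
An ∞-proof is cut at its modal inferences: below them lies a finite tree, its main tree, whose modal
leaves carry the premises as unanalysed subproofs. In a main tree the cut on `A` is eliminated by
the usual induction on `A` and on the tree. A cut on a boxed formula is not eliminated but pushed
into the premises of the modal inferences, where it becomes a formal cut term on smaller formulas
and subproofs; evaluating this term one layer at a time, productively, gives the result.

The evaluation yields an ∞-proof because two cut terms whose `n`-fragments agree for all `n` are
related by the least fixed point `ProofEq`: its inductive part admits only finitely many passages
out of the current `≈`-class, which is the branch condition. All statements are about pairs of
derivations, relative to a set `M` of admitted rules. On the diagonal they say that the result is an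
∞-proof, the choice of `M` expresses absence of cuts or slimness, and pairs of distinct derivations
give non-expansiveness.
-/

noncomputable instance Formula.instDecidableEq : DecidableEq Formula := Classical.decEq _

/-- Finite trees of non-modal inferences that end in initial sequents and in modal inferences.
The premises of the modal inferences are represented by elements of `X`. Sequents are omitted: they
are determined by the sequent at the root. -/
inductive MainTree (X : Type) : Type
  | ax : MainTree X
  | impL : Formula → Formula → MainTree X → MainTree X → MainTree X
  | impR : Formula → Formula → MainTree X → MainTree X
  | cut : Formula → MainTree X → MainTree X → MainTree X
  | box : Formula → Finset Formula → Multiset Formula → Multiset Formula → X → MainTree X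
  | boxPlus : Formula → Finset Formula → Multiset Formula → Multiset Formula → X → X → MainTree X

/-- The antecedent of the premises of a modal inference. -/
def premAnt (S₀ : Finset Formula) (L P : Multiset Formula) : Multiset Formula :=
  S₀.val + L + P + P.map Formula.boxPlus

/-- The part of the antecedent of the conclusion of a modal inference that is used by it. -/
def boxedAnt (L P : Multiset Formula) : Multiset Formula :=
  L.map Formula.box + P.map Formula.boxPlus

/-- Restrictions on the inferences of a derivation: absence of cuts and slimness. -/
structure Mode : Type where
  noCut : Prop
  slim : Prop

/-- `S ; Γ ⇒ Δ` is an initial sequent for every `S`. -/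
def IsInitial (Γ Δ : Multiset Formula) : Prop :=
  Formula.bot ∈ Γ ∨ ∃ p, Formula.var p ∈ Γ ∧ Formula.var p ∈ Δ

/-- Side conditions of modal inferences. -/
structure ModalCondition (M : Mode) (S : Set Formula) (Γ : Multiset Formula) (S₀ : Finset Formula)
    (L P : Multiset Formula) : Prop where
  sub : (↑S₀ : Set Formula) ⊆ S
  le : boxedAnt L P ≤ Γ
  slim : M.slim → L.Nodup ∧ P.Nodup

/-- Relations between representations of the premise of a modal inference, for each annotation of
this premise and each sequent at it. -/
abbrev PremiseRel (X : Type) : Type := Annot → Sequent → X → X → Prop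

/-- `Derives M ρ S Γ Δ m m'`: the trees `m` and `m'` consist of the same inferences, which are
allowed by `M`, they derive the sequent `S ; Γ ⇒ Δ`, and the representations of the premises of
modal inferences are pairwise related by `ρ`: by `ρ (some A)` for the right premise of `□⁺` with the
principal formula `□⁺ A`, and by `ρ none` for other premises. -/
inductive Derives {X : Type} (M : Mode) (ρ : PremiseRel X) (S : Set Formula) :
    Multiset Formula → Multiset Formula → MainTree X → MainTree X → Prop
  | ax {Γ Δ} (h : IsInitial Γ Δ) : Derives M ρ S Γ Δ .ax .ax
  | impL {Γ Γ₀ Δ A B l r l' r'} (e : Γ = Formula.imp A B ::ₘ Γ₀)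
      (hl : Derives M ρ S (B ::ₘ Γ₀) Δ l l') (hr : Derives M ρ S Γ₀ (A ::ₘ Δ) r r') :
      Derives M ρ S Γ Δ (.impL A B l r) (.impL A B l' r')
  | impR {Γ Δ Δ₀ A B t t'} (e : Δ = Formula.imp A B ::ₘ Δ₀)
      (h : Derives M ρ S (A ::ₘ Γ) (B ::ₘ Δ₀) t t') :
      Derives M ρ S Γ Δ (.impR A B t) (.impR A B t')
  | cut {Γ Δ A l r l' r'} (hM : ¬ M.noCut)
      (hl : Derives M ρ S Γ (A ::ₘ Δ) l l') (hr : Derives M ρ S (A ::ₘ Γ) Δ r r') :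
      Derives M ρ S Γ Δ (.cut A l r) (.cut A l' r')
  | box {Γ Δ A S₀ L P x x'} (hm : ModalCondition M S Γ S₀ L P) (hA : Formula.box A ∈ Δ)
      (hx : ρ none ⟨S, premAnt S₀ L P, {A}⟩ x x') :
      Derives M ρ S Γ Δ (.box A S₀ L P x) (.box A S₀ L P x')
  | boxPlus {Γ Δ A S₀ L P x x' y y'} (hm : ModalCondition M S Γ S₀ L P) (hA : Formula.boxPlus A ∈ Δ)
      (hx : ρ none ⟨S, premAnt S₀ L P, {A}⟩ x x')
      (hy : ρ (some A) ⟨S, premAnt S₀ L P, {Formula.boxPlus A}⟩ y y') :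
      Derives M ρ S Γ Δ (.boxPlus A S₀ L P x y) (.boxPlus A S₀ L P x' y')

section Structural

variable {X : Type} {M : Mode} {ρ σ κ : PremiseRel X} {S : Set Formula}
  {Γ Γ' Δ Δ' : Multiset Formula} {m m' p p' q q' : MainTree X} {A B : Formula}

theorem IsInitial.mono (h : IsInitial Γ Δ) (hΓ : Γ ≤ Γ') (hΔ : Δ ≤ Δ') : IsInitial Γ' Δ' := by
  rcases h with h | ⟨p, h₁, h₂⟩
  · exact Or.inl (Multiset.mem_of_le hΓ h)
  · exact Or.inr ⟨p, Multiset.mem_of_le hΓ h₁, Multiset.mem_of_le hΔ h₂⟩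

theorem IsInitial.of_mem (h : IsInitial Γ Δ) (hΓ : ∀ C ∈ Γ, (∀ A B, C ≠ .imp A B) → C ∈ Γ')
    (hΔ : ∀ C ∈ Δ, (∀ A B, C ≠ .imp A B) → C ∈ Δ') : IsInitial Γ' Δ' := by
  rcases h with h | ⟨p, h₁, h₂⟩
  · exact Or.inl (hΓ _ h (by simp))
  · exact Or.inr ⟨p, hΓ _ h₁ (by simp), hΔ _ h₂ (by simp)⟩

theorem IsInitial.of_cons_right (h : IsInitial Γ (A ::ₘ Δ)) (hA : ∀ p, A ≠ .var p) :
    IsInitial Γ Δ := by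
  rcases h with h | ⟨p, h₁, h₂⟩
  · exact Or.inl h
  · exact Or.inr ⟨p, h₁, (Multiset.mem_cons.1 h₂).resolve_left (hA p).symm⟩

theorem imp_notMem_boxedAnt {L P : Multiset Formula} : Formula.imp A B ∉ boxedAnt L P := by
  simp [boxedAnt]

theorem ModalCondition.mono {S₀ : Finset Formula} {L P : Multiset Formula}
    (h : ModalCondition M S Γ S₀ L P) (hΓ : Γ ≤ Γ') : ModalCondition M S Γ' S₀ L P :=
  ⟨h.sub, h.le.trans hΓ, h.slim⟩

theorem ModalCondition.of_cons {S₀ : Finset Formula} {L P : Multiset Formula}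
    (h : ModalCondition M S (A ::ₘ Γ) S₀ L P) (hA : A ∉ boxedAnt L P) :
    ModalCondition M S Γ S₀ L P :=
  ⟨h.sub, (Multiset.le_cons_of_notMem hA).1 h.le, h.slim⟩

theorem Derives.mono (h : Derives M ρ S Γ Δ m m') (hρ : ρ ≤ σ) :
    Derives M σ S Γ Δ m m' := by
  induction h with
  | ax h => exact .ax h
  | impL e _ _ hl hr => exact .impL e hl hr
  | impR e _ h => exact .impR e h
  | cut hM _ _ hl hr => exact .cut hM hl hr
  | box hm hA hx => exact .box hm hA (hρ _ _ _ _ hx)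
  | boxPlus hm hA hx hy => exact .boxPlus hm hA (hρ _ _ _ _ hx) (hρ _ _ _ _ hy)

theorem Derives.weaken (h : Derives M ρ S Γ Δ m m') (hΓ : Γ ≤ Γ') (hΔ : Δ ≤ Δ') :
    Derives M ρ S Γ' Δ' m m' := by
  obtain ⟨Γ₁, rfl⟩ := Multiset.le_iff_exists_add.1 hΓ
  obtain ⟨Δ₁, rfl⟩ := Multiset.le_iff_exists_add.1 hΔ
  clear hΓ hΔ
  induction h with
  | ax h => exact .ax (h.mono (Multiset.le_add_right _ _) (Multiset.le_add_right _ _))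
  | impL e _ _ hl hr =>
    subst e
    exact .impL (Multiset.cons_add _ _ _) (by simpa using hl) (by simpa using hr)
  | impR e _ h =>
    subst e
    exact .impR (Multiset.cons_add _ _ _) (by simpa using h)
  | cut hM _ _ hl hr => exact .cut hM (by simpa using hl) (by simpa using hr)
  | box hm hA hx =>
    exact .box (hm.mono (Multiset.le_add_right _ _)) (Multiset.mem_add.2 (Or.inl hA)) hx
  | boxPlus hm hA hx hy =>
    exact .boxPlus (hm.mono (Multiset.le_add_right _ _)) (Multiset.mem_add.2 (Or.inl hA)) hx hy

/-- Inversion of the rule `→_R`. -/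
noncomputable def MainTree.invR (A B : Formula) : MainTree X → MainTree X
  | .ax => .ax
  | .impL C D l r => .impL C D (l.invR A B) (r.invR A B)
  | .impR C D t => if C = A ∧ D = B then t else .impR C D (t.invR A B)
  | .cut C l r => .cut C (l.invR A B) (r.invR A B)
  | .box C S₀ L P x => .box C S₀ L P x
  | .boxPlus C S₀ L P x y => .boxPlus C S₀ L P x y

/-- Inversion of the rule `→_L` with respect to the left premise. -/
noncomputable def MainTree.invLL (A B : Formula) : MainTree X → MainTree X
  | .ax => .ax
  | .impL C D l r => if C = A ∧ D = B then l else .impL C D (l.invLL A B) (r.invLL A B)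
  | .impR C D t => .impR C D (t.invLL A B)
  | .cut C l r => .cut C (l.invLL A B) (r.invLL A B)
  | .box C S₀ L P x => .box C S₀ L P x
  | .boxPlus C S₀ L P x y => .boxPlus C S₀ L P x y

/-- Inversion of the rule `→_L` with respect to the right premise. -/
noncomputable def MainTree.invLR (A B : Formula) : MainTree X → MainTree X
  | .ax => .ax
  | .impL C D l r => if C = A ∧ D = B then r else .impL C D (l.invLR A B) (r.invLR A B)
  | .impR C D t => .impR C D (t.invLR A B)
  | .cut C l r => .cut C (l.invLR A B) (r.invLR A B)
  | .box C S₀ L P x => .box C S₀ L P x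
  | .boxPlus C S₀ L P x y => .boxPlus C S₀ L P x y

theorem Derives.invR (h : Derives M ρ S Γ (Formula.imp A B ::ₘ Δ) m m') :
    Derives M ρ S (A ::ₘ Γ) (B ::ₘ Δ) (m.invR A B) (m'.invR A B) := by
  generalize e : Formula.imp A B ::ₘ Δ = Δ' at h
  induction h generalizing Δ with
  | ax h =>
    subst e
    exact .ax (h.of_mem (by simp +contextual) (by simp +contextual))
  | impL e' _ _ hl hr =>
    subst e e'
    refine .impL (Multiset.cons_swap _ _ _) ?_ ?_
    · rw [Multiset.cons_swap]; exact hl rfl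
    · rw [Multiset.cons_swap]; exact hr (Multiset.cons_swap _ _ _)
  | @impR Γ Δ' Δ₀ C D t t' e' h ih =>
    subst e
    simp only [MainTree.invR]
    rcases Multiset.cons_eq_cons.1 e' with ⟨h₁, rfl⟩ | ⟨h₁, Δ₁, rfl, rfl⟩
    · cases h₁
      simpa using h
    · rw [if_neg (by rintro ⟨rfl, rfl⟩; exact h₁ rfl), if_neg (by rintro ⟨rfl, rfl⟩; exact h₁ rfl)]
      refine .impR (Multiset.cons_swap _ _ _) ?_
      rw [Multiset.cons_swap, Multiset.cons_swap _ B]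
      exact ih (Multiset.cons_swap _ _ _)
  | cut hM _ _ hl hr =>
    subst e
    refine .cut hM ?_ ?_
    · rw [Multiset.cons_swap]; exact hl (Multiset.cons_swap _ _ _)
    · rw [Multiset.cons_swap]; exact hr rfl
  | box hm hA hx =>
    subst e
    exact .box (hm.mono (Multiset.le_cons_self _ _))
      (Multiset.mem_cons_of_mem (by simpa using hA)) hx
  | boxPlus hm hA hx hy =>
    subst e
    exact .boxPlus (hm.mono (Multiset.le_cons_self _ _))
      (Multiset.mem_cons_of_mem (by simpa using hA)) hx hy

theorem Derives.invLL (h : Derives M ρ S (Formula.imp A B ::ₘ Γ) Δ m m') :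
    Derives M ρ S (B ::ₘ Γ) Δ (m.invLL A B) (m'.invLL A B) := by
  generalize e : Formula.imp A B ::ₘ Γ = Γ' at h
  induction h generalizing Γ with
  | ax h =>
    subst e
    exact .ax (h.of_mem (by simp +contextual) (by simp +contextual))
  | @impL Γ' Γ₀ Δ C D l r l' r' e' hl hr ihl ihr =>
    subst e
    simp only [MainTree.invLL]
    rcases Multiset.cons_eq_cons.1 e' with ⟨h₁, rfl⟩ | ⟨h₁, Γ₁, rfl, rfl⟩
    · cases h₁
      simpa using hl
    · rw [if_neg (by rintro ⟨rfl, rfl⟩; exact h₁ rfl), if_neg (by rintro ⟨rfl, rfl⟩; exact h₁ rfl)]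
      refine .impL (Multiset.cons_swap _ _ _) ?_ (ihr rfl)
      rw [Multiset.cons_swap]
      exact ihl (Multiset.cons_swap _ _ _)
  | impR e' _ h =>
    subst e e'
    refine .impR rfl ?_
    rw [Multiset.cons_swap]
    exact h (Multiset.cons_swap _ _ _)
  | cut hM _ _ hl hr =>
    subst e
    refine .cut hM (hl rfl) ?_
    rw [Multiset.cons_swap]; exact hr (Multiset.cons_swap _ _ _)
  | box hm hA hx =>
    subst e
    exact .box ((hm.of_cons imp_notMem_boxedAnt).mono (Multiset.le_cons_self _ _)) hA hx
  | boxPlus hm hA hx hy =>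
    subst e
    exact .boxPlus ((hm.of_cons imp_notMem_boxedAnt).mono (Multiset.le_cons_self _ _)) hA hx hy

theorem Derives.invLR (h : Derives M ρ S (Formula.imp A B ::ₘ Γ) Δ m m') :
    Derives M ρ S Γ (A ::ₘ Δ) (m.invLR A B) (m'.invLR A B) := by
  generalize e : Formula.imp A B ::ₘ Γ = Γ' at h
  induction h generalizing Γ with
  | ax h =>
    subst e
    exact .ax (h.of_mem (by simp +contextual) (by simp +contextual))
  | @impL Γ' Γ₀ Δ C D l r l' r' e' hl hr ihl ihr =>
    subst e
    simp only [MainTree.invLR]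
    rcases Multiset.cons_eq_cons.1 e' with ⟨h₁, rfl⟩ | ⟨h₁, Γ₁, rfl, rfl⟩
    · cases h₁
      simpa using hr
    · rw [if_neg (by rintro ⟨rfl, rfl⟩; exact h₁ rfl), if_neg (by rintro ⟨rfl, rfl⟩; exact h₁ rfl)]
      refine .impL rfl (ihl (Multiset.cons_swap _ _ _)) ?_
      rw [Multiset.cons_swap]
      exact ihr rfl
  | impR e' _ h =>
    subst e e'
    refine .impR (Multiset.cons_swap _ _ _) ?_
    rw [Multiset.cons_swap]
    exact h (Multiset.cons_swap _ _ _)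
  | cut hM _ _ hl hr =>
    subst e
    refine .cut hM ?_ (hr (Multiset.cons_swap _ _ _))
    rw [Multiset.cons_swap]; exact hl rfl
  | box hm hA hx =>
    subst e
    exact .box (hm.of_cons imp_notMem_boxedAnt) (Multiset.mem_cons_of_mem hA) hx
  | boxPlus hm hA hx hy =>
    subst e
    exact .boxPlus (hm.of_cons imp_notMem_boxedAnt) (Multiset.mem_cons_of_mem hA) hx hy

theorem Derives.erase_right (h : Derives M ρ S Γ (A ::ₘ Δ) m m') (hA : ∀ C D, A ≠ .imp C D)
    (hΔ : A ≠ .bot → A ∈ Δ) : Derives M ρ S Γ Δ m m' := by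
  have mem_of_ne_bot {Δ₁ C} (hΔ₁ : A ≠ .bot → A ∈ Δ₁) (hC : C ∈ A ::ₘ Δ₁) (hb : C ≠ .bot) :
      C ∈ Δ₁ := by
    rcases Multiset.mem_cons.1 hC with rfl | hC
    exacts [hΔ₁ hb, hC]
  generalize e : A ::ₘ Δ = Δ' at h
  induction h generalizing Δ with
  | ax h =>
    subst e
    rcases h with h | ⟨p, hp, hp'⟩
    · exact .ax (Or.inl h)
    · exact .ax (Or.inr ⟨p, hp, mem_of_ne_bot hΔ hp' (by simp)⟩)
  | impL e' _ _ hl hr =>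
    subst e
    exact .impL e' (hl hΔ rfl)
      (hr (fun hb => Multiset.mem_cons_of_mem (hΔ hb)) (Multiset.cons_swap _ _ _))
  | impR e' _ h =>
    subst e
    obtain ⟨h₁, -⟩ | ⟨-, Δ₁, rfl, rfl⟩ := Multiset.cons_eq_cons.1 e'
    · exact absurd h₁ (hA _ _)
    · have hΔ₁ (hb : A ≠ .bot) : A ∈ Δ₁ :=
        (Multiset.mem_cons.1 (hΔ hb)).resolve_left (hA _ _)
      exact .impR rfl
        (h (fun hb => Multiset.mem_cons_of_mem (hΔ₁ hb)) (Multiset.cons_swap _ _ _))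
  | cut hM _ _ hl hr =>
    subst e
    exact .cut hM (hl (fun hb => Multiset.mem_cons_of_mem (hΔ hb)) (Multiset.cons_swap _ _ _))
      (hr hΔ rfl)
  | box hm hB hx => subst e; exact .box hm (mem_of_ne_bot hΔ hB (by simp)) hx
  | boxPlus hm hB hx hy => subst e; exact .boxPlus hm (mem_of_ne_bot hΔ hB (by simp)) hx hy

theorem Derives.erase_var_left {n : ℕ} (h : Derives M ρ S (Formula.var n ::ₘ Γ) Δ m m')
    (hn : IsInitial Γ (Formula.var n ::ₘ Δ)) : Derives M ρ S Γ Δ m m' := by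
  generalize e : Formula.var n ::ₘ Γ = Γ' at h
  induction h generalizing Γ with
  | ax h =>
    subst e
    refine .ax ?_
    rcases h with h | ⟨p, h₁, h₂⟩
    · exact Or.inl (by simpa using h)
    · by_cases hp : p = n
      · subst hp
        rcases hn with h | ⟨k, h₃, h₄⟩
        · exact Or.inl h
        · rcases Multiset.mem_cons.1 h₄ with h | h
          · cases h; exact Or.inr ⟨p, h₃, h₂⟩
          · exact Or.inr ⟨k, h₃, h⟩
      · exact Or.inr ⟨p, by simpa [hp] using h₁, h₂⟩
  | impL e' _ _ hl hr =>
    subst e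
    obtain ⟨h₁, -⟩ | ⟨-, Γ₁, rfl, rfl⟩ := Multiset.cons_eq_cons.1 e'
    · cases h₁
    · refine .impL rfl (hl ?_ (Multiset.cons_swap _ _ _)) (hr ?_ rfl)
      · exact hn.of_mem (by simp +contextual) (by simp +contextual)
      · exact hn.of_mem (by simp +contextual) (by simp +contextual)
  | impR e' _ h =>
    subst e e'
    exact .impR rfl (h (hn.of_mem (by simp +contextual) (by simp +contextual))
      (Multiset.cons_swap _ _ _))
  | cut hM _ _ hl hr =>
    subst e
    exact .cut hM (hl (hn.mono le_rfl (by simp [Multiset.le_cons_self])) rfl)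
      (hr (hn.mono (Multiset.le_cons_self _ _) le_rfl) (Multiset.cons_swap _ _ _))
  | box hm hA hx => subst e; exact .box (hm.of_cons (by simp [boxedAnt])) hA hx
  | boxPlus hm hA hx hy => subst e; exact .boxPlus (hm.of_cons (by simp [boxedAnt])) hA hx hy

/-- The trees that end in a modal inference. -/
def MainTree.IsModal : MainTree X → Prop
  | .box .. => True
  | .boxPlus .. => True
  | _ => False

/-- Permutation of a cut with premises `p` and `q` upwards over the non-modal inferences of `p`. -/
noncomputable def MainTree.permute (k : MainTree X → MainTree X → MainTree X) :
    MainTree X → MainTree X → MainTree X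
  | .ax, q => k .ax q
  | .impL A B l r, q => .impL A B (l.permute k (q.invLL A B)) (r.permute k (q.invLR A B))
  | .impR A B t, q => .impR A B (t.permute k (q.invR A B))
  | .cut A l r, q => .cut A (l.permute k q) (r.permute k q)
  | .box A S₀ L P x, q => k (.box A S₀ L P x) q
  | .boxPlus A S₀ L P x y, q => k (.boxPlus A S₀ L P x y) q

theorem Derives.permute {k : MainTree X → MainTree X → MainTree X} (hA : ∀ B C, A ≠ .imp B C)
    (hp : Derives M ρ S Γ (A ::ₘ Δ) p p') (hq : Derives M σ S (A ::ₘ Γ) Δ q q')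
    (hk : ∀ {Γ Δ p p' q q'}, p = .ax ∨ p.IsModal → Derives M ρ S Γ (A ::ₘ Δ) p p' →
      Derives M σ S (A ::ₘ Γ) Δ q q' → Derives M κ S Γ Δ (k p q) (k p' q')) :
    Derives M κ S Γ Δ (p.permute k q) (p'.permute k q') := by
  generalize e : A ::ₘ Δ = Δ' at hp
  induction hp generalizing Δ q q' with
  | ax h => subst e; exact hk (Or.inl rfl) (.ax h) hq
  | impL e' _ _ hl hr =>
    subst e e'
    rw [Multiset.cons_swap] at hq
    refine .impL rfl (hl ?_ rfl) (hr hq.invLR (Multiset.cons_swap _ _ _))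
    rw [Multiset.cons_swap]; exact hq.invLL
  | @impR Γ Δ' Δ₀ C D t t' e' h ih =>
    subst e
    rcases Multiset.cons_eq_cons.1 e' with ⟨h₁, rfl⟩ | ⟨-, Δ₁, rfl, rfl⟩
    · exact absurd h₁ (hA _ _)
    · refine .impR rfl (ih ?_ (Multiset.cons_swap _ _ _))
      rw [Multiset.cons_swap]; exact hq.invR
  | cut hM _ _ hl hr =>
    subst e
    refine .cut hM (hl (hq.weaken le_rfl (Multiset.le_cons_self _ _)) (Multiset.cons_swap _ _ _))
      (hr (hq.weaken ?_ le_rfl) rfl)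
    rw [Multiset.cons_swap]; exact Multiset.le_cons_self _ _
  | box hm hB hx => subst e; exact hk (Or.inr trivial) (.box hm hB hx) hq
  | boxPlus hm hB hx hy => subst e; exact hk (Or.inr trivial) (.boxPlus hm hB hx hy) hq

/-- Replacement of the modal inferences of a tree. -/
def MainTree.mapModal (k : MainTree X → MainTree X) : MainTree X → MainTree X
  | .ax => .ax
  | .impL A B l r => .impL A B (l.mapModal k) (r.mapModal k)
  | .impR A B t => .impR A B (t.mapModal k)
  | .cut A l r => .cut A (l.mapModal k) (r.mapModal k)
  | .box A S₀ L P x => k (.box A S₀ L P x)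
  | .boxPlus A S₀ L P x y => k (.boxPlus A S₀ L P x y)

theorem Derives.mapModal {k k' : MainTree X → MainTree X} {L P : Multiset Formula}
    (hA : A = .box B ∨ A = .boxPlus B) (hΓ : boxedAnt L P ≤ Γ)
    (hq : Derives M σ S (A ::ₘ Γ) Δ q q')
    (hk : ∀ {Γ Δ q q'}, q.IsModal → boxedAnt L P ≤ Γ →
      Derives M σ S (A ::ₘ Γ) Δ q q' → Derives M κ S Γ Δ (k q) (k' q')) :
    Derives M κ S Γ Δ (q.mapModal k) (q'.mapModal k') := by
  generalize e : A ::ₘ Γ = Γ' at hq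
  induction hq generalizing Γ with
  | ax h =>
    subst e
    refine .ax ?_
    rcases h with h | ⟨p, h₁, h₂⟩
    · exact Or.inl (by rcases hA with rfl | rfl <;> simpa using h)
    · exact Or.inr ⟨p, by rcases hA with rfl | rfl <;> simpa using h₁, h₂⟩
  | impL e' _ _ hl hr =>
    subst e
    obtain ⟨h₁, -⟩ | ⟨-, Γ₁, rfl, rfl⟩ := Multiset.cons_eq_cons.1 e'
    · subst h₁; simp at hA
    · have hΓ₁ := (Multiset.le_cons_of_notMem imp_notMem_boxedAnt).1 hΓ
      exact .impL rfl (hl (hΓ₁.trans (Multiset.le_cons_self _ _)) (Multiset.cons_swap _ _ _))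
        (hr hΓ₁ rfl)
  | impR e' _ h =>
    subst e e'
    exact .impR rfl (h (hΓ.trans (Multiset.le_cons_self _ _)) (Multiset.cons_swap _ _ _))
  | cut hM _ _ hl hr =>
    subst e
    exact .cut hM (hl hΓ rfl)
      (hr (hΓ.trans (Multiset.le_cons_self _ _)) (Multiset.cons_swap _ _ _))
  | box hm hB hx => subst e; exact hk trivial hΓ (.box hm hB hx)
  | boxPlus hm hB hx hy => subst e; exact hk trivial hΓ (.boxPlus hm hB hx hy)

theorem Derives.forall {ι : Type*} [Nonempty ι] {τ : ι → PremiseRel X}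
    (h : ∀ i, Derives M (τ i) S Γ Δ m m') :
    Derives M (fun a c x x' => ∀ i, τ i a c x x') S Γ Δ m m' := by
  have h₀ := h (Classical.arbitrary ι)
  induction h₀ with
  | ax hi => exact .ax hi
  | impL e _ _ hl hr =>
    subst e
    refine .impL rfl (hl fun i => ?_) (hr fun i => ?_) <;>
    · cases h i with | impL e hl hr => ?_
      rw [Multiset.cons_inj_right] at e
      subst e
      assumption
  | impR e _ ih =>
    subst e
    refine .impR rfl (ih fun i => ?_)
    cases h i with | impR e h => ?_
    rw [Multiset.cons_inj_right] at e
    subst e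
    assumption
  | cut hM _ _ hl hr =>
    refine .cut hM (hl fun i => ?_) (hr fun i => ?_) <;>
    · cases h i
      assumption
  | box hm hA _ => exact .box hm hA fun i => by cases h i; assumption
  | boxPlus hm hA _ _ =>
    exact .boxPlus hm hA (fun i => by cases h i; assumption) (fun i => by cases h i; assumption)

end Structural

section Merge

variable {M : Mode} {S : Set Formula} {Γ : Multiset Formula} {B : Formula}
  {S₀ S₁ : Finset Formula} {L P L₁ P₁ : Multiset Formula}

theorem count_box_boxedAnt (A : Formula) :
    (boxedAnt L P).count (Formula.box A) = L.count A := by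
  have h : (P.map Formula.boxPlus).count (Formula.box A) = 0 :=
    Multiset.count_eq_zero.2 (by simp)
  rw [boxedAnt, Multiset.count_add, h, add_zero]
  exact Multiset.count_map_eq_count' _ _ (fun _ _ h => by cases h; rfl) _

theorem count_boxPlus_boxedAnt (A : Formula) :
    (boxedAnt L P).count (Formula.boxPlus A) = P.count A := by
  have h : (L.map Formula.box).count (Formula.boxPlus A) = 0 :=
    Multiset.count_eq_zero.2 (by simp)
  rw [boxedAnt, Multiset.count_add, h, zero_add]
  exact Multiset.count_map_eq_count' _ _ (fun _ _ h => by cases h; rfl) _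

theorem boxedAnt_le_iff : boxedAnt L P ≤ Γ ↔
    (∀ A, L.count A ≤ Γ.count (Formula.box A)) ∧ ∀ A, P.count A ≤ Γ.count (Formula.boxPlus A) := by
  rw [Multiset.le_iff_count]
  constructor
  · intro h
    refine ⟨fun A => ?_, fun A => ?_⟩
    · rw [← count_box_boxedAnt (P := P)]; exact h _
    · rw [← count_boxPlus_boxedAnt (L := L)]; exact h _
  · rintro ⟨h₁, h₂⟩ A
    by_cases hA : A ∈ boxedAnt L P
    · simp only [boxedAnt, Multiset.mem_add, Multiset.mem_map] at hA
      rcases hA with ⟨C, -, rfl⟩ | ⟨C, -, rfl⟩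
      · rw [count_box_boxedAnt]; exact h₁ _
      · rw [count_boxPlus_boxedAnt]; exact h₂ _
    · rw [Multiset.count_eq_zero.2 hA]; exact Nat.zero_le _

theorem ModalCondition.union (h₀ : ModalCondition M S Γ S₀ L P)
    (h₁ : ModalCondition M S Γ S₁ L₁ P₁) :
    ModalCondition M S Γ (S₀ ∪ S₁) (L ∪ L₁) (P ∪ P₁) := by
  refine ⟨?_, ?_, fun hs => ?_⟩
  · rw [Finset.coe_union]; exact Set.union_subset h₀.sub h₁.sub
  · have h₂ := boxedAnt_le_iff.1 h₀.le
    have h₃ := boxedAnt_le_iff.1 h₁.le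
    refine boxedAnt_le_iff.2 ⟨fun A => ?_, fun A => ?_⟩
    · rw [Multiset.count_union]; exact max_le (h₂.1 A) (h₃.1 A)
    · rw [Multiset.count_union]; exact max_le (h₂.2 A) (h₃.2 A)
  · exact ⟨Multiset.nodup_union.2 ⟨(h₀.slim hs).1, (h₁.slim hs).1⟩,
      Multiset.nodup_union.2 ⟨(h₀.slim hs).2, (h₁.slim hs).2⟩⟩

theorem ModalCondition.of_box (h : ModalCondition M S (Formula.box B ::ₘ Γ) S₀ (B ::ₘ L) P) :
    ModalCondition M S Γ S₀ L P := by
  refine ⟨h.sub, ?_, fun hs => ⟨(Multiset.nodup_cons.1 (h.slim hs).1).2, (h.slim hs).2⟩⟩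
  have := h.le
  rw [boxedAnt, Multiset.map_cons, Multiset.cons_add] at this
  exact (Multiset.cons_le_cons_iff _).1 this

theorem ModalCondition.of_boxPlus
    (h : ModalCondition M S (Formula.boxPlus B ::ₘ Γ) S₀ L (B ::ₘ P)) :
    ModalCondition M S Γ S₀ L P := by
  refine ⟨h.sub, ?_, fun hs => ⟨(h.slim hs).1, (Multiset.nodup_cons.1 (h.slim hs).2).2⟩⟩
  have := h.le
  rw [boxedAnt, Multiset.map_cons, Multiset.add_cons] at this
  exact (Multiset.cons_le_cons_iff _).1 this

theorem premAnt_mono (h₀ : S₀ ⊆ S₁) (hL : L ≤ L₁) (hP : P ≤ P₁) :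
    premAnt S₀ L P ≤ premAnt S₁ L₁ P₁ :=
  add_le_add (add_le_add (add_le_add (Finset.val_le_iff.2 h₀) hL) hP) (Multiset.map_le_map hP)

theorem premAnt_le_union_left :
    premAnt S₀ L P ≤ premAnt (S₀ ∪ S₁) (L ∪ L₁) (P ∪ P₁) :=
  premAnt_mono Finset.subset_union_left Multiset.le_union_left Multiset.le_union_left

theorem premAnt_le_union_right : premAnt S₁ L₁ P₁ ≤ premAnt (S₀ ∪ S₁) (L ∪ L₁) (P ∪ P₁) :=
  premAnt_mono Finset.subset_union_right Multiset.le_union_right Multiset.le_union_right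

theorem premAnt_cons_left : premAnt S₀ (B ::ₘ L) P = B ::ₘ premAnt S₀ L P := by
  simp [premAnt]

theorem premAnt_cons_right :
    premAnt S₀ L (B ::ₘ P) = Formula.boxPlus B ::ₘ B ::ₘ premAnt S₀ L P := by
  simp only [premAnt, Multiset.map_cons, Multiset.add_cons, Multiset.cons_add]

theorem premAnt_cons_left_le_cons_union :
    premAnt S₁ (B ::ₘ L₁) P₁ ≤ B ::ₘ premAnt (S₀ ∪ S₁) (L ∪ L₁) (P ∪ P₁) := by
  rw [premAnt_cons_left]
  exact Multiset.cons_le_cons _ premAnt_le_union_right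

theorem premAnt_cons_right_le_cons_union :
    premAnt S₁ L₁ (B ::ₘ P₁) ≤
      Formula.boxPlus B ::ₘ B ::ₘ premAnt (S₀ ∪ S₁) (L ∪ L₁) (P ∪ P₁) := by
  rw [premAnt_cons_right]
  exact Multiset.cons_le_cons _ (Multiset.cons_le_cons _ premAnt_le_union_right)

end Merge

/-- Terms built from trees by pending eliminations of cuts: `elim A Δ t u` stands for the
elimination of the cut with the premises `t`, `u` and the cut formula `A`, where `Δ` is the
right-hand side of the conclusion. -/
inductive CutTerm : Type
  | leaf : SeqTree → CutTerm
  | elim : Formula → Multiset Formula → CutTerm → CutTerm → CutTerm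

namespace MainTree

/-- The elimination of the cut with the cut formula `□ B` whose left premise is obtained by the
rule `□`, where the right premise is a modal inference. -/
noncomputable def mergeBox (B : Formula) (S₀ : Finset Formula) (L P : Multiset Formula)
    (x : CutTerm) : MainTree CutTerm → MainTree CutTerm
  | .box A S₁ L₁ P₁ y =>
    if B ∈ L₁ then .box A (S₀ ∪ S₁) (L ∪ L₁.erase B) (P ∪ P₁) (.elim B {A} x y)
    else .box A S₁ L₁ P₁ y
  | .boxPlus A S₁ L₁ P₁ y z =>
    if B ∈ L₁ then .boxPlus A (S₀ ∪ S₁) (L ∪ L₁.erase B) (P ∪ P₁) (.elim B {A} x y)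
      (.elim B {Formula.boxPlus A} x z)
    else .boxPlus A S₁ L₁ P₁ y z
  | m => m

/-- The premise obtained by the elimination of two cuts with the cut formulas `□⁺ B` and `B`. -/
def elimTwo (B : Formula) (x x₁ : CutTerm) (C : Formula) (y : CutTerm) : CutTerm :=
  .elim B {C} x (.elim (Formula.boxPlus B) {C} x₁ y)

/-- The elimination of the cut with the cut formula `□⁺ B` whose left premise is obtained by the
rule `□⁺`, where the right premise is a modal inference. -/
noncomputable def mergeBoxPlus (B : Formula) (S₀ : Finset Formula) (L P : Multiset Formula)
    (x x₁ : CutTerm) : MainTree CutTerm → MainTree CutTerm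
  | .box A S₁ L₁ P₁ y =>
    if B ∈ P₁ then .box A (S₀ ∪ S₁) (L ∪ L₁) (P ∪ P₁.erase B) (elimTwo B x x₁ A y)
    else .box A S₁ L₁ P₁ y
  | .boxPlus A S₁ L₁ P₁ y z =>
    if B ∈ P₁ then .boxPlus A (S₀ ∪ S₁) (L ∪ L₁) (P ∪ P₁.erase B) (elimTwo B x x₁ A y)
      (elimTwo B x x₁ (Formula.boxPlus A) z)
    else .boxPlus A S₁ L₁ P₁ y z
  | m => m

/-- The elimination of the cut with the cut formula `□ B` whose left premise is initial or modal. -/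
noncomputable def reduceBox (B : Formula) : MainTree CutTerm → MainTree CutTerm → MainTree CutTerm
  | .box A S₀ L P x, q =>
    if A = B then q.mapModal (mergeBox B S₀ L P x) else .box A S₀ L P x
  | p, _ => p

/-- The elimination of the cut with the cut formula `□⁺ B` whose left premise is initial or
modal. -/
noncomputable def reduceBoxPlus (B : Formula) :
    MainTree CutTerm → MainTree CutTerm → MainTree CutTerm
  | .boxPlus A S₀ L P x x₁, q =>
    if A = B then q.mapModal (mergeBoxPlus B S₀ L P x x₁) else .boxPlus A S₀ L P x x₁
  | p, _ => p

/-- The elimination of the cut whose cut formula is a variable and whose left premise is initial or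
modal. -/
def reduceVar : MainTree CutTerm → MainTree CutTerm → MainTree CutTerm
  | .ax, q => q
  | p, _ => p

/-- The elimination of a cut above the modal inferences that are the nearest to the root. -/
noncomputable def elimCut : Formula → Multiset Formula →
    MainTree CutTerm → MainTree CutTerm → MainTree CutTerm
  | .var _, _, p, q => p.permute reduceVar q
  | .bot, _, p, _ => p
  | .imp A B, Δ, p, q =>
    elimCut B Δ (elimCut A (B ::ₘ Δ) (q.invLR A B) (p.invR A B)) (q.invLL A B)
  | .box B, _, p, q => p.permute (reduceBox B) q
  | .boxPlus B, Δ, p, q =>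
    if Formula.boxPlus B ∈ Δ then p else p.permute (reduceBoxPlus B) q

end MainTree

section Reduce

open MainTree

variable {M : Mode} {ρ σ κ : PremiseRel CutTerm} {S : Set Formula}
  {Γ Δ : Multiset Formula} {p p' q q' : MainTree CutTerm} {B : Formula}

theorem Sequent.none_mem_Ann (c : Sequent) : (none : Annot) ∈ c.Ann := by
  intro A h; cases h

theorem Sequent.some_mem_Ann (S : Set Formula) (Γ : Multiset Formula) (A : Formula) :
    (some A : Annot) ∈ (Sequent.mk S Γ {Formula.boxPlus A}).Ann := by
  intro C h; cases h; simp

theorem Derives.reduceVar {n : ℕ} (hl : p = .ax ∨ p.IsModal)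
    (hp : Derives M ρ S Γ (Formula.var n ::ₘ Δ) p p')
    (hq : Derives M ρ S (Formula.var n ::ₘ Γ) Δ q q') :
    Derives M ρ S Γ Δ (reduceVar p q) (reduceVar p' q') := by
  cases hp with
  | ax h => exact hq.erase_var_left h
  | box hm hA hx => exact .box hm (by simpa using hA) hx
  | boxPlus hm hA hx hy => exact .boxPlus hm (by simpa using hA) hx hy
  | impL | impR | cut => simp [IsModal] at hl

theorem Derives.mergeBox {S₀ : Finset Formula} {L P : Multiset Formula} {x x' : CutTerm}
    (hσ : σ ≤ κ)
    (hcut : ∀ {a Θ₁ Θ C y y'}, a ∈ (Sequent.mk S Θ {C}).Ann → premAnt S₀ L P ≤ Θ → Θ₁ ≤ B ::ₘ Θ →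
      σ a ⟨S, Θ₁, {C}⟩ y y' → κ a ⟨S, Θ, {C}⟩ (.elim B {C} x y) (.elim B {C} x' y'))
    (hm : ModalCondition M S Γ S₀ L P) (hl : q.IsModal)
    (hq : Derives M σ S (Formula.box B ::ₘ Γ) Δ q q') :
    Derives M κ S Γ Δ (q.mergeBox B S₀ L P x) (q'.mergeBox B S₀ L P x') := by
  cases hq with
  | @box _ _ A S₁ L₁ P₁ y y' hm₁ hA hy =>
    by_cases hB : B ∈ L₁
    · obtain ⟨L₂, rfl⟩ := Multiset.exists_cons_of_mem hB
      simp only [MainTree.mergeBox, hB, if_true, Multiset.erase_cons_head]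
      exact .box (hm.union hm₁.of_box) hA
        (hcut (Sequent.none_mem_Ann _) premAnt_le_union_left premAnt_cons_left_le_cons_union hy)
    · simp only [MainTree.mergeBox, hB, if_false]
      exact .box (hm₁.of_cons (by simpa [boxedAnt] using hB)) hA (hσ _ _ _ _ hy)
  | @boxPlus _ _ A S₁ L₁ P₁ y y' z z' hm₁ hA hy hz =>
    by_cases hB : B ∈ L₁
    · obtain ⟨L₂, rfl⟩ := Multiset.exists_cons_of_mem hB
      simp only [MainTree.mergeBox, hB, if_true, Multiset.erase_cons_head]
      exact .boxPlus (hm.union hm₁.of_box) hA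
        (hcut (Sequent.none_mem_Ann _) premAnt_le_union_left premAnt_cons_left_le_cons_union hy)
        (hcut (Sequent.some_mem_Ann _ _ _) premAnt_le_union_left premAnt_cons_left_le_cons_union hz)
    · simp only [MainTree.mergeBox, hB, if_false]
      exact .boxPlus (hm₁.of_cons (by simpa [boxedAnt] using hB)) hA (hσ _ _ _ _ hy)
        (hσ _ _ _ _ hz)
  | ax | impL | impR | cut => exact hl.elim

theorem Derives.mergeBoxPlus {S₀ : Finset Formula} {L P : Multiset Formula} {x x' x₁ x₁' : CutTerm}
    (hσ : σ ≤ κ)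
    (hcut : ∀ {a Θ₁ Θ C y y'}, a ∈ (Sequent.mk S Θ {C}).Ann → premAnt S₀ L P ≤ Θ →
      Θ₁ ≤ Formula.boxPlus B ::ₘ B ::ₘ Θ → σ a ⟨S, Θ₁, {C}⟩ y y' →
      κ a ⟨S, Θ, {C}⟩ (elimTwo B x x₁ C y) (elimTwo B x' x₁' C y'))
    (hm : ModalCondition M S Γ S₀ L P) (hl : q.IsModal)
    (hq : Derives M σ S (Formula.boxPlus B ::ₘ Γ) Δ q q') :
    Derives M κ S Γ Δ (q.mergeBoxPlus B S₀ L P x x₁) (q'.mergeBoxPlus B S₀ L P x' x₁') := by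
  cases hq with
  | @box _ _ A S₁ L₁ P₁ y y' hm₁ hA hy =>
    by_cases hB : B ∈ P₁
    · obtain ⟨P₂, rfl⟩ := Multiset.exists_cons_of_mem hB
      simp only [MainTree.mergeBoxPlus, hB, if_true, Multiset.erase_cons_head]
      exact .box (hm.union hm₁.of_boxPlus) hA
        (hcut (Sequent.none_mem_Ann _) premAnt_le_union_left premAnt_cons_right_le_cons_union hy)
    · simp only [MainTree.mergeBoxPlus, hB, if_false]
      exact .box (hm₁.of_cons (by simpa [boxedAnt] using hB)) hA (hσ _ _ _ _ hy)
  | @boxPlus _ _ A S₁ L₁ P₁ y y' z z' hm₁ hA hy hz =>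
    by_cases hB : B ∈ P₁
    · obtain ⟨P₂, rfl⟩ := Multiset.exists_cons_of_mem hB
      simp only [MainTree.mergeBoxPlus, hB, if_true, Multiset.erase_cons_head]
      exact .boxPlus (hm.union hm₁.of_boxPlus) hA
        (hcut (Sequent.none_mem_Ann _) premAnt_le_union_left premAnt_cons_right_le_cons_union hy)
        (hcut (Sequent.some_mem_Ann _ _ _) premAnt_le_union_left
          premAnt_cons_right_le_cons_union hz)
    · simp only [MainTree.mergeBoxPlus, hB, if_false]
      exact .boxPlus (hm₁.of_cons (by simpa [boxedAnt] using hB)) hA (hσ _ _ _ _ hy)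
        (hσ _ _ _ _ hz)
  | ax | impL | impR | cut => exact hl.elim

theorem Derives.permute_reduceBox
    (hρ : ρ ≤ κ) (hσ : σ ≤ κ)
    (hcut : ∀ {a Θ₀ Θ₁ Θ C x x' y y'}, a ∈ (Sequent.mk S Θ {C}).Ann → Θ₀ ≤ Θ → Θ₁ ≤ B ::ₘ Θ →
      ρ none ⟨S, Θ₀, {B}⟩ x x' → σ a ⟨S, Θ₁, {C}⟩ y y' →
      κ a ⟨S, Θ, {C}⟩ (.elim B {C} x y) (.elim B {C} x' y'))
    (hp : Derives M ρ S Γ (Formula.box B ::ₘ Δ) p p')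
    (hq : Derives M σ S (Formula.box B ::ₘ Γ) Δ q q') :
    Derives M κ S Γ Δ (p.permute (reduceBox B) q) (p'.permute (reduceBox B) q') := by
  refine hp.permute (by simp) hq fun {Γ Δ p p' q q'} hl hp hq => ?_
  cases hp with
  | ax h => exact .ax (h.of_cons_right (by simp))
  | @box _ _ A S₀ L P x x' hm hA hx =>
    by_cases hB : A = B
    · subst hB
      simp only [MainTree.reduceBox, if_true]
      exact hq.mapModal (Or.inl rfl) hm.le fun hl hle hq =>
        hq.mergeBox hσ (fun ha h₀ h₁ hy => hcut ha h₀ h₁ hx hy)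
          ⟨hm.sub, hle, hm.slim⟩ hl
    · simp only [MainTree.reduceBox, hB, if_false]
      exact .box hm (by simpa [hB] using hA) (hρ _ _ _ _ hx)
  | boxPlus hm hA hx hy =>
    exact .boxPlus hm (by simpa using hA) (hρ _ _ _ _ hx) (hρ _ _ _ _ hy)
  | impL | impR | cut => simp [IsModal] at hl

theorem Derives.permute_reduceBoxPlus
    (hρ : ρ ≤ κ) (hσ : σ ≤ κ)
    (hcut : ∀ {a Θ₀ Θ₁ Θ C x x' x₁ x₁' y y'}, a ∈ (Sequent.mk S Θ {C}).Ann → Θ₀ ≤ Θ →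
      Θ₁ ≤ Formula.boxPlus B ::ₘ B ::ₘ Θ → ρ none ⟨S, Θ₀, {B}⟩ x x' →
      ρ (some B) ⟨S, Θ₀, {Formula.boxPlus B}⟩ x₁ x₁' → σ a ⟨S, Θ₁, {C}⟩ y y' →
      κ a ⟨S, Θ, {C}⟩ (elimTwo B x x₁ C y) (elimTwo B x' x₁' C y'))
    (hp : Derives M ρ S Γ (Formula.boxPlus B ::ₘ Δ) p p')
    (hq : Derives M σ S (Formula.boxPlus B ::ₘ Γ) Δ q q') :
    Derives M κ S Γ Δ (p.permute (reduceBoxPlus B) q) (p'.permute (reduceBoxPlus B) q') := by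
  refine hp.permute (by simp) hq fun {Γ Δ p p' q q'} hl hp hq => ?_
  cases hp with
  | ax h => exact .ax (h.of_cons_right (by simp))
  | @boxPlus _ _ A S₀ L P x x' x₁ x₁' hm hA hx hx₁ =>
    by_cases hB : A = B
    · subst hB
      simp only [MainTree.reduceBoxPlus, if_true]
      exact hq.mapModal (Or.inr rfl) hm.le fun hl hle hq =>
        hq.mergeBoxPlus hσ
          (fun ha h₀ h₁ hy => hcut ha h₀ h₁ hx hx₁ hy)
          ⟨hm.sub, hle, hm.slim⟩ hl
    · simp only [MainTree.reduceBoxPlus, hB, if_false]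
      exact .boxPlus hm (by simpa [hB] using hA) (hρ _ _ _ _ hx) (hρ _ _ _ _ hx₁)
  | box hm hA hx => exact .box hm (by simpa using hA) (hρ _ _ _ _ hx)
  | impL | impR | cut => simp [IsModal] at hl

end Reduce

/-- The finite tree at the root of the tree represented by a term, where `out` gives this finite
tree for the leaves of the term. -/
noncomputable def CutTerm.head (out : SeqTree → MainTree CutTerm) : CutTerm → MainTree CutTerm
  | .leaf t => out t
  | .elim A Δ t u => MainTree.elimCut A Δ (t.head out) (u.head out)

/-- Relations between trees, represented by terms, that derive a given sequent. -/
abbrev TermRel : Type := Sequent → CutTerm → CutTerm → Prop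

/-- The relation for the premises of a modal inference in a tree annotated with `s`: `Y` is used for
the right premise of `□⁺` that retains the annotation, and `X` is used otherwise. -/
def layer (X Y : TermRel) (s : Annot) : PremiseRel CutTerm :=
  fun a c t t' => if a ≠ none ∧ a = s then Y c t t' else X c t t'

/-- The `i`-fragments of the trees annotated with `s` coincide up to the relation `X` between
subtrees whose roots are not equivalent to the root. -/
def FragEq (out : SeqTree → MainTree CutTerm) (M : Mode) (X : TermRel) (s : Annot) : ℕ → TermRel
  | 0 => fun _ _ _ => True
  | i + 1 => fun c t t' =>
    Derives M (layer X (FragEq out M X s i) s) c.ctx c.ant c.suc (t.head out) (t'.head out)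

section Fragments

variable {out : SeqTree → MainTree CutTerm} {M : Mode} {X X' Y Y' : TermRel} {s a : Annot} {i : ℕ}
  {c : Sequent} {S : Set Formula} {Γ Γ' Δ Δ' : Multiset Formula} {t t' : CutTerm}

theorem layer_mono (hX : X ≤ X') (hY : Y ≤ Y') : layer X Y s ≤ layer X' Y' s := by
  intro a c t t' h
  unfold layer at *
  split_ifs at * with ha
  · exact hY _ _ _ h
  · exact hX _ _ _ h

theorem layer_none_right : layer X Y none a c t t' ↔ X c t t' :=
  iff_of_eq (if_neg fun h => h.1 h.2)

theorem layer_none_left : layer X Y s none c t t' ↔ X c t t' :=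
  iff_of_eq (if_neg fun h => h.1 rfl)

theorem FragEq.mono (hX : X ≤ Y) : FragEq out M X s i ≤ FragEq out M Y s i := by
  induction i with
  | zero => exact le_rfl
  | succ i ih => exact fun _ _ _ h => Derives.mono h (layer_mono hX ih)

theorem FragEq.weaken (h : FragEq out M X s i ⟨S, Γ, Δ⟩ t t') (hΓ : Γ ≤ Γ') (hΔ : Δ ≤ Δ') :
    FragEq out M X s i ⟨S, Γ', Δ'⟩ t t' := by
  cases i with
  | zero => trivial
  | succ i => exact Derives.weaken h hΓ hΔ

/-- The operator on relations whose least fixed point is `ProofEq`. -/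
def proofEqHom (out : SeqTree → MainTree CutTerm) (M : Mode) : TermRel →o TermRel where
  toFun X c t t' := ∃ s, ∀ i, FragEq out M X s i c t t'
  monotone' _ _ hXY c t t' := fun ⟨s, h⟩ => ⟨s, fun i => FragEq.mono hXY c t t' (h i)⟩

/-- The trees represented by the terms coincide and are `∞`-proofs of the given sequent: every
branch eventually retains its annotation, because a step that does not retain it descends in the
least fixed point. -/
def ProofEq (out : SeqTree → MainTree CutTerm) (M : Mode) : TermRel :=
  (proofEqHom out M).lfp

theorem proofEq_iff :
    ProofEq out M c t t' ↔ ∃ s, ∀ i, FragEq out M (ProofEq out M) s i c t t' :=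
  iff_of_eq (congrFun₃ (proofEqHom out M).map_lfp c t t').symm

theorem ProofEq.of_fragEq (s : Annot) (h : ∀ i, FragEq out M (ProofEq out M) s i c t t') :
    ProofEq out M c t t' :=
  proofEq_iff.2 ⟨s, h⟩

theorem ProofEq.le_of_fragEq_le (hX : ∀ s c t t',
    (∀ i, FragEq out M (ProofEq out M ⊓ X) s i c t t') → X c t t') : ProofEq out M ≤ X := by
  refine (OrderHom.lfp_le _ fun c t t' ⟨s, h⟩ => ?_ : ProofEq out M ≤ ProofEq out M ⊓ X).trans
    inf_le_right
  exact ⟨.of_fragEq s fun i => FragEq.mono inf_le_left c t t' (h i), hX s c t t' h⟩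

theorem ProofEq.derives (h : ProofEq out M c t t') :
    Derives M (fun _ => ProofEq out M) c.ctx c.ant c.suc (t.head out) (t'.head out) := by
  obtain ⟨s, hs⟩ := proofEq_iff.1 h
  refine (Derives.forall fun i => hs (i + 1)).mono fun a c x x' hx => ?_
  by_cases ha : a ≠ none ∧ a = s
  · refine .of_fragEq s fun i => ?_
    simpa only [layer, if_pos ha] using hx i
  · simpa only [layer, if_neg ha] using hx 0

theorem ProofEq.le_layer (hY : ProofEq out M ≤ Y) :
    (fun _ => ProofEq out M) ≤ layer (ProofEq out M) Y s := by
  intro a c x x' hx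
  unfold layer
  split_ifs
  · exact hY _ _ _ hx
  · exact hx

theorem ProofEq.le_fragEq : ProofEq out M ≤ FragEq out M (ProofEq out M) s i := by
  induction i with
  | zero => exact fun _ _ _ _ => trivial
  | succ i ih => exact fun _ _ _ h => h.derives.mono (le_layer ih)

theorem ProofEq.of_fragEq_none (h : FragEq out M (ProofEq out M) none (i + 1) c t t') :
    ProofEq out M c t t' := by
  refine .of_fragEq none fun j => ?_
  cases j with
  | zero => trivial
  | succ j => exact Derives.mono h fun a c x x' hx => layer_none_right.2 (layer_none_right.1 hx)

theorem ProofEq.weaken (h : ProofEq out M ⟨S, Γ, Δ⟩ t t') (hΓ : Γ ≤ Γ') (hΔ : Δ ≤ Δ') :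
    ProofEq out M ⟨S, Γ', Δ'⟩ t t' :=
  .of_fragEq_none (i := 0) ((le_fragEq _ _ _ h).weaken hΓ hΔ)

end Fragments

/-- The relation for the premises of a modal inference in the `(i + 1)`-fragments of trees annotated
with `s` that coincide. -/
def fragLayer (out : SeqTree → MainTree CutTerm) (M : Mode) (s : Annot) (i : ℕ) :
    PremiseRel CutTerm :=
  layer (ProofEq out M) (FragEq out M (ProofEq out M) s i) s

/-- Elimination of cuts with the cut formula `B` respects the fragments. -/
def CutEliminable (out : SeqTree → MainTree CutTerm) (M : Mode) (B : Formula) : Prop :=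
  ∀ {s : Annot} {i : ℕ} {S : Set Formula} {Γ Δ : Multiset Formula} {p p' q q' : MainTree CutTerm},
    s ∈ (Sequent.mk S Γ Δ).Ann →
    Derives M (fragLayer out M s i) S Γ (B ::ₘ Δ) p p' →
    Derives M (fragLayer out M s i) S (B ::ₘ Γ) Δ q q' →
    Derives M (fragLayer out M s i) S Γ Δ (MainTree.elimCut B Δ p q) (MainTree.elimCut B Δ p' q')

section CutElimination

variable {out : SeqTree → MainTree CutTerm} {M : Mode} {s a : Annot} {i : ℕ}
  {c : Sequent} {S : Set Formula} {Γ Γ' Δ Δ' : Multiset Formula} {t t' u u' : CutTerm}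
  {p p' q q' : MainTree CutTerm} {ρ σ : PremiseRel CutTerm} {A B : Formula}

theorem fragLayer_none_left : fragLayer out M s i none c t t' ↔ ProofEq out M c t t' :=
  layer_none_left

theorem fragLayer_weaken (h : fragLayer out M s i a ⟨S, Γ, Δ⟩ t t') (hΓ : Γ ≤ Γ')
    (hΔ : Δ ≤ Δ') : fragLayer out M s i a ⟨S, Γ', Δ'⟩ t t' := by
  unfold fragLayer layer at *
  split_ifs at *
  · exact h.weaken hΓ hΔ
  · exact h.weaken hΓ hΔ

theorem CutEliminable.elim_fragEq (hB : CutEliminable out M B) (hs : s ∈ (Sequent.mk S Γ Δ).Ann)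
    (ht : FragEq out M (ProofEq out M) s i ⟨S, Γ, B ::ₘ Δ⟩ t t')
    (hu : FragEq out M (ProofEq out M) s i ⟨S, B ::ₘ Γ, Δ⟩ u u') :
    FragEq out M (ProofEq out M) s i ⟨S, Γ, Δ⟩ (.elim B Δ t u) (.elim B Δ t' u') := by
  cases i with
  | zero => trivial
  | succ i => exact hB hs ht hu

theorem CutEliminable.elim_proofEq (hB : CutEliminable out M B)
    (ht : ProofEq out M ⟨S, Γ, B ::ₘ Δ⟩ t t') (hu : ProofEq out M ⟨S, B ::ₘ Γ, Δ⟩ u u') :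
    ProofEq out M ⟨S, Γ, Δ⟩ (.elim B Δ t u) (.elim B Δ t' u') :=
  .of_fragEq_none (i := 0) <|
    hB.elim_fragEq (Sequent.none_mem_Ann _) (ht.le_fragEq _ _ _) (hu.le_fragEq _ _ _)

theorem CutEliminable.elim_fragLayer (hB : CutEliminable out M B) (ha : a ∈ (Sequent.mk S Γ Δ).Ann)
    (ht : ProofEq out M ⟨S, Γ, B ::ₘ Δ⟩ t t')
    (hu : fragLayer out M s i a ⟨S, B ::ₘ Γ, Δ⟩ u u') :
    fragLayer out M s i a ⟨S, Γ, Δ⟩ (.elim B Δ t u) (.elim B Δ t' u') := by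
  unfold fragLayer layer at *
  split_ifs at * with has
  · exact hB.elim_fragEq (has.2 ▸ ha) (ProofEq.le_fragEq _ _ _ ht) hu
  · exact hB.elim_proofEq ht hu

theorem cutEliminable_var (n : ℕ) : CutEliminable out M (.var n) :=
  fun _ hp hq => hp.permute (by simp) hq fun hl hp hq => hp.reduceVar hl hq

theorem cutEliminable_bot : CutEliminable out M .bot :=
  fun _ hp _ => hp.erase_right (by simp) (by simp)

theorem CutEliminable.imp (hA : CutEliminable out M A) (hB : CutEliminable out M B) :
    CutEliminable out M (.imp A B) := by
  intro s i S Γ Δ p p' q q' hs hp hq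
  refine hB hs (hA (fun C hC => Multiset.mem_cons_of_mem (hs C hC)) ?_ hp.invR) hq.invLL
  exact hq.invLR.weaken le_rfl (Multiset.cons_le_cons _ (Multiset.le_cons_self _ _))

theorem CutEliminable.box (hB : CutEliminable out M B) : CutEliminable out M (.box B) := by
  intro s i S Γ Δ p p' q q' _ hp hq
  refine hp.permute_reduceBox le_rfl le_rfl (fun ha h₀ h₁ hx hy => ?_) hq
  exact hB.elim_fragLayer ha ((fragLayer_none_left.1 hx).weaken h₀ (by simp))
    (fragLayer_weaken hy h₁ le_rfl)

theorem CutEliminable.derives_elimCut_boxPlus (hB : CutEliminable out M B)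
    (hρ : ρ ≤ fragLayer out M s i) (hσ : σ ≤ fragLayer out M s i)
    (hρB : Formula.boxPlus B ∉ Δ → ρ (some B) ≤ ProofEq out M)
    (hcut : ∀ {a Θ₁ Θ C t t' u u'}, a ∈ (Sequent.mk S Θ {C}).Ann → Θ₁ ≤ Formula.boxPlus B ::ₘ Θ →
      ProofEq out M ⟨S, Θ, Formula.boxPlus B ::ₘ {C}⟩ t t' → σ a ⟨S, Θ₁, {C}⟩ u u' →
      fragLayer out M s i a ⟨S, Θ, {C}⟩
        (.elim (.boxPlus B) {C} t u) (.elim (.boxPlus B) {C} t' u'))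
    (hp : Derives M ρ S Γ (Formula.boxPlus B ::ₘ Δ) p p')
    (hq : Derives M σ S (Formula.boxPlus B ::ₘ Γ) Δ q q') :
    Derives M (fragLayer out M s i) S Γ Δ
      (MainTree.elimCut (.boxPlus B) Δ p q) (MainTree.elimCut (.boxPlus B) Δ p' q') := by
  by_cases hΔ : Formula.boxPlus B ∈ Δ
  · simp only [MainTree.elimCut, hΔ, if_true]
    exact (hp.mono hρ).erase_right (by simp) fun _ => hΔ
  · simp only [MainTree.elimCut, hΔ, if_false]
    refine hp.permute_reduceBoxPlus hρ hσ (fun {a Θ₀ Θ₁ Θ C x x' x₁ x₁' y y'} ha h₀ h₁ hx hx₁ hy =>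
      hB.elim_fragLayer ha ((fragLayer_none_left.1 (hρ _ _ _ _ hx)).weaken h₀ (by simp)) ?_) hq
    refine hcut ha h₁ ?_ hy
    exact (hρB hΔ _ _ _ hx₁).weaken (h₀.trans (Multiset.le_cons_self _ B)) (by simp)

theorem CutEliminable.elim_boxPlus_proofEq (hB : CutEliminable out M B)
    (hΓ : Γ' ≤ Formula.boxPlus B ::ₘ Γ) (hΔ : Δ' ≤ Δ)
    (ht : ProofEq out M ⟨S, Γ, Formula.boxPlus B ::ₘ Δ⟩ t t')
    (hu : ProofEq out M ⟨S, Γ', Δ'⟩ u u') :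
    ProofEq out M ⟨S, Γ, Δ⟩ (.elim (.boxPlus B) Δ t u) (.elim (.boxPlus B) Δ t' u') := by
  let X : TermRel := fun c u u' => ∀ {Γ Δ t t'}, c.ant ≤ Formula.boxPlus B ::ₘ Γ → c.suc ≤ Δ →
    ProofEq out M ⟨c.ctx, Γ, Formula.boxPlus B ::ₘ Δ⟩ t t' →
    ProofEq out M ⟨c.ctx, Γ, Δ⟩ (.elim (.boxPlus B) Δ t u) (.elim (.boxPlus B) Δ t' u')
  suffices ProofEq out M ≤ X from this _ _ _ hu hΓ hΔ ht
  refine ProofEq.le_of_fragEq_le fun s c u u' hu Γ Δ t t' hΓ hΔ ht => .of_fragEq s fun i => ?_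
  replace hu := hu i
  induction i generalizing c u u' Γ Δ t t' with
  | zero => trivial
  | succ i ih =>
    refine hB.derives_elimCut_boxPlus (ρ := fun _ => ProofEq out M)
      (σ := layer (ProofEq out M ⊓ X) (FragEq out M (ProofEq out M ⊓ X) s i) s)
      (ProofEq.le_layer ProofEq.le_fragEq) (layer_mono inf_le_left (FragEq.mono inf_le_left))
      (fun _ => le_rfl) ?_ ht.derives (Derives.weaken hu hΓ hΔ)
    intro a Θ₁ Θ C t t' u u' _ hΘ ht hu
    unfold fragLayer layer at *
    split_ifs at * with ha
    · exact ih ⟨_, Θ₁, {C}⟩ u u' Θ {C} t t' hΘ le_rfl ht hu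
    · exact hu.2 hΘ le_rfl ht

theorem CutEliminable.boxPlus (hB : CutEliminable out M B) : CutEliminable out M (.boxPlus B) := by
  intro s i S Γ Δ p p' q q' hs hp hq
  induction i using Nat.strong_induction_on generalizing Γ Δ p p' q q' with | _ i ih => ?_
  refine hB.derives_elimCut_boxPlus le_rfl le_rfl (fun hΔ c x x' hx => ?_) ?_ hp hq
  · exact (if_neg fun h => hΔ (hs B h.2.symm)).mp hx
  · intro a Θ₁ Θ C t t' u u' ha hΘ ht hu
    unfold fragLayer layer at *
    split_ifs at * with has
    · cases i with
      | zero => trivial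
      | succ i =>
        exact ih i i.lt_succ_self (has.2 ▸ ha) (ht.le_fragEq (i := i + 1) _ _ _)
          (hu.weaken hΘ le_rfl)
    · exact hB.elim_boxPlus_proofEq hΘ le_rfl ht hu

theorem cutEliminable (A : Formula) : CutEliminable out M A := by
  induction A with
  | var n => exact cutEliminable_var n
  | bot => exact cutEliminable_bot
  | imp A B hA hB => exact hA.imp hB
  | box B hB => exact hB.box
  | boxPlus B hB => exact hB.boxPlus

end CutElimination

namespace Rule

variable {s : Annot} {b : Bool} {r : Rule} {A : Formula} {k : ℕ∞}

/-- The passage from the conclusion of a rule to the premise `b` preserves the `≈`-class of the root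
of a tree annotated with `s`. -/
def Stays (s : Annot) (b : Bool) : Rule → Prop
  | .box _ => False
  | .boxPlus A => b = true ∧ s = some A
  | _ => True

open Classical in
/-- The `k`-fragment of a tree annotated with `s` intersects the subtree at the premise `b` of its
last rule in the fragment of this subtree with the index `r.level s b k`: an infinite index stands
for the whole tree, and `0` for the empty fragment. -/
noncomputable def level (s : Annot) (b : Bool) (k : ℕ∞) (r : Rule) : ℕ∞ :=
  if r.Stays s b then if r.IsModal then k - 1 else k else ⊤

theorem stays_of_not_isModal (hr : ¬ r.IsModal) : r.Stays s b := by
  cases r <;> first | trivial | exact (hr trivial).elim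

theorem Stays.eq_boxPlus (h : r.Stays s b) (hr : r.IsModal) :
    ∃ A, r = .boxPlus A ∧ b = true ∧ s = some A := by
  cases r with
  | boxPlus A => exact ⟨A, rfl, h⟩
  | box A => exact h.elim
  | _ => exact hr.elim

theorem not_stays_false (hr : r.IsModal) : ¬ r.Stays s false := by
  cases r <;> simp_all [Stays, IsModal]

theorem Stays.next_eq (h : r.Stays s b) : r.next s b = s := by
  cases r with
  | boxPlus A =>
    obtain ⟨rfl, rfl⟩ := h
    rfl
  | box A => exact h.elim
  | _ => rfl

theorem stays_of_next_eq (hr : r.IsModal) (h : r.next none b = s) (hs : s ≠ none) :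
    r.Stays s b := by
  subst h
  cases r with
  | boxPlus A => cases b <;> simp_all [Rule.next, Stays]
  | box A => exact (hs rfl).elim
  | _ => exact hr.elim

theorem level_of_not_isModal (hr : ¬ r.IsModal) : r.level s b k = k := by
  rw [level, if_pos (stays_of_not_isModal hr), if_neg hr]

theorem level_of_isModal_of_stays (hr : r.IsModal) (h : r.Stays s b) : r.level s b k = k - 1 := by
  rw [level, if_pos h, if_pos hr]

theorem Stays.level_le (h : r.Stays s b) : r.level s b k ≤ k := by
  rw [level, if_pos h]
  split_ifs
  exacts [tsub_le_self, le_rfl]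

theorem level_of_not_stays (h : ¬ r.Stays s b) : r.level s b k = ⊤ := if_neg h

theorem level_top : r.level s b ⊤ = ⊤ := by
  simp [level]

end Rule

section Paths

open Filter

theorem pathPrefix_succ (f : ℕ → Bool) (n : ℕ) :
    pathPrefix f (n + 1) = pathPrefix f n ++ [f n] := by
  simp [pathPrefix, List.range_succ]

theorem pathPrefix_add (f : ℕ → Bool) (n k : ℕ) :
    pathPrefix f (n + k) = pathPrefix f n ++ pathPrefix (fun i => f (n + i)) k := by
  simp [pathPrefix, List.range_add, Function.comp_def]

namespace SeqTree

variable {t : SeqTree} {f : ℕ → Bool} {n : ℕ}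

/-- The subtree at a node. -/
def sub (t : SeqTree) (w : List Bool) : SeqTree := fun v => t (w ++ v)

/-- The path is an infinite branch. -/
def IsBranch (t : SeqTree) (f : ℕ → Bool) : Prop := ∀ n, (t (pathPrefix f n)).isSome

/-- The condition on infinite branches of `∞`-proofs. -/
def HasGoodTail (t : SeqTree) (f : ℕ → Bool) : Prop := ∃ N A, GoodTail t f N A

theorem hasGoodTail_iff : t.HasGoodTail f ↔ ∃ A,
    (∀ᶠ n in atTop, ∀ r, t.ruleAt (pathPrefix f n) = some r → r.Stays (some A) (f n)) ∧
      ∃ᶠ n in atTop, ∃ r, t.ruleAt (pathPrefix f n) = some r ∧ r.IsModal := by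
  constructor
  · rintro ⟨N, A, ha, hb, hc, hd⟩
    refine ⟨A, eventually_atTop.2 ⟨N, fun n hn r hr => ?_⟩, frequently_atTop.2 fun m => ?_⟩
    · cases r with
      | box B => exact (hd n hn B hr).elim
      | boxPlus B => exact ⟨by simpa using hc n hn B hr, by rw [ha n hn B hr]⟩
      | _ => trivial
    · obtain ⟨n, hn, B, hB, -⟩ := hb m
      exact ⟨n, hn, _, hB, trivial⟩
  · rintro ⟨A, hstays, hmodal⟩
    obtain ⟨N, hN⟩ := eventually_atTop.1 hstays
    refine ⟨N, A, fun n hn B hB => ?_, fun m => ?_, fun n hn B hB => ?_,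
      fun n hn B hB => hN n hn _ hB⟩
    · exact (Option.some.inj (hN n hn _ hB).2).symm
    · obtain ⟨n, hn, ⟨r, hr, hm⟩, hs⟩ := frequently_atTop.1 (hmodal.and_eventually hstays) m
      obtain ⟨B, rfl, hf, -⟩ := (hs r hr).eq_boxPlus hm
      exact ⟨n, hn, B, hr, hf⟩
    · simp [(hN n hn _ hB).1]

theorem HasGoodTail.of_stays {s : Annot}
    (hstays : ∀ n r, t.ruleAt (pathPrefix f n) = some r → r.Stays s (f n))
    (hmodal : ∀ n, ∃ i r, t.ruleAt (pathPrefix f (n + i)) = some r ∧ r.IsModal) :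
    t.HasGoodTail f := by
  obtain ⟨i, r, hr, hm⟩ := hmodal 0
  obtain ⟨A, -, -, rfl⟩ := (hstays _ r hr).eq_boxPlus hm
  refine hasGoodTail_iff.2 ⟨A, .of_forall hstays, frequently_atTop.2 fun n => ?_⟩
  obtain ⟨i, hi⟩ := hmodal n
  exact ⟨n + i, Nat.le_add_right n i, hi⟩

theorem ruleAt_sub_nil (t : SeqTree) (w : List Bool) : (t.sub w).ruleAt [] = t.ruleAt w := by
  rw [ruleAt, ruleAt, sub, List.append_nil]

theorem hasGoodTail_sub_iff :
    (t.sub (pathPrefix f n)).HasGoodTail (fun i => f (n + i)) ↔ t.HasGoodTail f := by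
  have hrule (k : ℕ) : (t.sub (pathPrefix f n)).ruleAt (pathPrefix (fun i => f (n + i)) k) =
      t.ruleAt (pathPrefix f (k + n)) := by
    rw [add_comm, pathPrefix_add]
    rfl
  simp only [hasGoodTail_iff, hrule]
  conv_rhs => rw [← map_add_atTop_eq_nat n]
  simp only [eventually_map, frequently_map, add_comm n]

theorem IsBranch.sub (h : t.IsBranch f) (n : ℕ) :
    (t.sub (pathPrefix f n)).IsBranch fun i => f (n + i) := by
  intro k
  have := h (n + k)
  rwa [pathPrefix_add] at this

theorem exists_path {St : Type*} (tree : St → SeqTree) (R : St → Bool → St → Prop)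
    (h : ∀ σ, ∃ b σ', tree σ' = (tree σ).sub [b] ∧ R σ b σ') (σ₀ : St) :
    ∃ (f : ℕ → Bool) (σ : ℕ → St), (∀ n, R (σ n) (f n) (σ (n + 1))) ∧
      ∀ n, tree (σ n) = (tree σ₀).sub (pathPrefix f n) := by
  choose g next hg hR using h
  let σ : ℕ → St := fun n => Nat.rec σ₀ (fun _ τ => next τ) n
  refine ⟨fun n => g (σ n), σ, fun n => hR (σ n), fun n => ?_⟩
  induction n with
  | zero => rfl
  | succ n ih =>
    funext w
    rw [pathPrefix_succ, sub, List.append_assoc]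
    exact (congrFun (hg (σ n)) w).trans (congrFun ih _)

end SeqTree

end Paths

namespace SeqTree

open Filter

variable {t : SeqTree} {c d : Sequent} {r : Rule} {b : Bool} {w : List Bool}

/-- The tree underlies an `∞`-proof. -/
structure IsProof (t : SeqTree) : Prop where
  root_mem : (t []).isSome
  closed : ∀ w b, t w = none → t (w ++ [b]) = none
  step : ∀ w c r, t w = some (c, r) →
    ∃ ps : List Sequent, Inference c r ps ∧ ∀ b : Bool, t.seqAt (w ++ [b]) = ps[b.toNat]?
  branch : ∀ f, t.IsBranch f → t.HasGoodTail f

theorem IsProof.of_infProof (π : InfProof) : IsProof π.tree :=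
  ⟨π.root_mem, π.closed, π.step, π.branch⟩

/-- The `∞`-proof with a given underlying tree. -/
def IsProof.toInfProof (h : t.IsProof) : InfProof :=
  ⟨t, h.root_mem, h.closed, h.step, h.branch⟩

theorem IsProof.sub (h : t.IsProof) (hb : (t [b]).isSome) : (t.sub [b]).IsProof where
  root_mem := hb
  closed w := h.closed (b :: w)
  step w := h.step (b :: w)
  branch f hf := by
    let g : ℕ → Bool := fun n => Nat.casesOn n b f
    have hg : (fun i => g (1 + i)) = f := funext fun i => by rw [add_comm]
    have hprefix (n : ℕ) : pathPrefix g (1 + n) = b :: pathPrefix f n := by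
      rw [pathPrefix_add, hg]
      rfl
    have hbranch : t.IsBranch g := by
      rintro (_ | n)
      · exact h.root_mem
      · rw [add_comm, hprefix]
        exact hf n
    have := hasGoodTail_sub_iff (n := 1).2 (h.branch g hbranch)
    rwa [hg] at this

theorem ruleAt_nil_of_eq (h : t [] = some (c, r)) : t.ruleAt [] = some r :=
  congrArg (Option.map Prod.snd) h

theorem isSome_of_seqAt_eq (h : t.seqAt w = some d) : (t w).isSome := by
  obtain ⟨x, hx, -⟩ := Option.map_eq_some_iff.1 h
  exact Option.isSome_iff_exists.2 ⟨x, hx⟩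

theorem IsProof.isBranch_of_sub {f : ℕ → Bool} (h : ∀ n, (t.sub (pathPrefix f n)).IsProof) :
    t.IsBranch f := by
  intro n
  have := (h n).root_mem
  rwa [SeqTree.sub, List.append_nil] at this

/-- The induction is well-founded because every infinite branch passes through modal inferences
infinitely many times. -/
theorem IsProof.induction_not_isModal {P : SeqTree → Prop}
    (h : ∀ t : SeqTree, t.IsProof → (∀ b r, t.ruleAt [] = some r → ¬ r.IsModal →
      (t [b]).isSome → P (t.sub [b])) → P t) (ht : t.IsProof) : P t := by
  by_contra hP
  have hstep (u : {u : SeqTree // u.IsProof ∧ ¬ P u}) : ∃ b, ∃ u' : {u // u.IsProof ∧ ¬ P u},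
      u'.1 = u.1.sub [b] ∧ ∃ r, u.1.ruleAt [] = some r ∧ ¬ r.IsModal := by
    by_contra hn
    refine u.2.2 (h u u.2.1 fun b r hr hm hb => ?_)
    by_contra hPb
    exact hn ⟨b, ⟨u.1.sub [b], u.2.1.sub hb, hPb⟩, rfl, r, hr, hm⟩
  obtain ⟨f, σ, hσ, hsub⟩ := exists_path Subtype.val _ hstep ⟨t, ht, hP⟩
  have hproof (n : ℕ) : (t.sub (pathPrefix f n)).IsProof := hsub n ▸ (σ n).2.1
  obtain ⟨A, -, hmodal⟩ := hasGoodTail_iff.1 (ht.branch f (isBranch_of_sub hproof))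
  obtain ⟨n, r, hr, hm⟩ := hmodal.exists
  obtain ⟨r', hr', hm'⟩ := hσ n
  rw [hsub, ruleAt_sub_nil] at hr'
  obtain rfl := Option.some.inj (hr.symm.trans hr')
  exact hm' hm

end SeqTree

namespace SeqTree

variable {t t' : SeqTree} {c d : Sequent} {r : Rule} {b : Bool} {w : List Bool} {M : Mode}
  {L P Θ : Multiset Formula}

/-- The possibilities for the inference at the root. -/
inductive RootStep (t : SeqTree) (c : Sequent) : Rule → Prop
  | ax (h : IsInitial c.ant c.suc) : RootStep t c .ax
  | impL {A B Γ₀} (e : c.ant = Formula.imp A B ::ₘ Γ₀)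
      (hl : t.seqAt [false] = some ⟨c.ctx, B ::ₘ Γ₀, c.suc⟩)
      (hr : t.seqAt [true] = some ⟨c.ctx, Γ₀, A ::ₘ c.suc⟩) : RootStep t c (.impL A B)
  | impR {A B Δ₀} (e : c.suc = Formula.imp A B ::ₘ Δ₀)
      (hl : t.seqAt [false] = some ⟨c.ctx, A ::ₘ c.ant, B ::ₘ Δ₀⟩) : RootStep t c (.impR A B)
  | cut {A} (hl : t.seqAt [false] = some ⟨c.ctx, c.ant, A ::ₘ c.suc⟩)
      (hr : t.seqAt [true] = some ⟨c.ctx, A ::ₘ c.ant, c.suc⟩) : RootStep t c (.cut A)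
  | box {A Θ} (h : ∃ L P, ModalStep c.ctx c.ant Θ L P) (hA : Formula.box A ∈ c.suc)
      (hl : t.seqAt [false] = some ⟨c.ctx, Θ, {A}⟩) : RootStep t c (.box A)
  | boxPlus {A Θ} (h : ∃ L P, ModalStep c.ctx c.ant Θ L P) (hA : Formula.boxPlus A ∈ c.suc)
      (hl : t.seqAt [false] = some ⟨c.ctx, Θ, {A}⟩)
      (hr : t.seqAt [true] = some ⟨c.ctx, Θ, {Formula.boxPlus A}⟩) : RootStep t c (.boxPlus A)

theorem IsProof.rootStep (h : t.IsProof) (hc : t [] = some (c, r)) : RootStep t c r := by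
  obtain ⟨ps, hps, hb⟩ := h.step [] c r hc
  have hf := hb false
  have ht := hb true
  simp only [List.nil_append, Bool.toNat_false, Bool.toNat_true] at hf ht
  cases hps with
  | axVar S Γ Δ p => exact .ax (Or.inr ⟨p, by simp, by simp⟩)
  | axBot S Γ Δ => exact .ax (Or.inl (by simp))
  | impL S Γ Δ A B => exact .impL rfl hf ht
  | impR S Γ Δ A B => exact .impR rfl hf
  | box S Γ Θ L P Ψ A hm => exact .box ⟨L, P, hm⟩ (by simp) hf
  | boxPlus S Γ Θ L P Ψ A hm => exact .boxPlus ⟨L, P, hm⟩ (by simp) hf ht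
  | cut S Γ Δ A => exact .cut hf ht

/-- The components of `x` are the finite subset of the context and the multisets of boxed formulas
of a modal inference with the conclusion `c` and the (left) premise `d`. The multisets have no
repetitions if the inference is slim. -/
def IsModalData (c d : Sequent) (x : Finset Formula × Multiset Formula × Multiset Formula) : Prop :=
  ModalCondition ⟨True, ∃ L P, L.Nodup ∧ P.Nodup ∧ ModalStep c.ctx c.ant d.ant L P⟩
    c.ctx c.ant x.1 x.2.1 x.2.2 ∧ d.ant = premAnt x.1 x.2.1 x.2.2

/-- A choice of the data of a modal inference with the conclusion `c` and the (left) premise `d`. -/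
noncomputable def modalData (c d : Sequent) :
    Finset Formula × Multiset Formula × Multiset Formula :=
  Classical.epsilon (IsModalData c d)

theorem exists_modalCondition (h : ModalStep c.ctx c.ant Θ L P)
    (hs : M.slim → L.Nodup ∧ P.Nodup) :
    ∃ S₀ : Finset Formula, ModalCondition M c.ctx c.ant S₀ L P ∧ Θ = premAnt S₀ L P := by
  obtain ⟨Φ, S₀, h₁, h₂, h₃⟩ := h
  refine ⟨S₀, ⟨h₁, ?_, hs⟩, h₃⟩
  rw [h₂, add_assoc]
  exact Multiset.le_add_left _ _

theorem modalData_spec (h : ∃ L P, ModalStep c.ctx c.ant d.ant L P)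
    (hs : M.slim → ∃ L P : Multiset Formula, L.Nodup ∧ P.Nodup ∧
      ModalStep c.ctx c.ant d.ant L P) :
    ModalCondition M c.ctx c.ant (modalData c d).1 (modalData c d).2.1 (modalData c d).2.2 ∧
      d.ant = premAnt (modalData c d).1 (modalData c d).2.1 (modalData c d).2.2 := by
  obtain ⟨L, P, hm, hslim⟩ : ∃ L P, ModalStep c.ctx c.ant d.ant L P ∧
      ((∃ L P, L.Nodup ∧ P.Nodup ∧ ModalStep c.ctx c.ant d.ant L P) → L.Nodup ∧ P.Nodup) := by
    by_cases hN : ∃ L P, L.Nodup ∧ P.Nodup ∧ ModalStep c.ctx c.ant d.ant L P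
    · obtain ⟨L, P, hL, hP, hm⟩ := hN
      exact ⟨L, P, hm, fun _ => ⟨hL, hP⟩⟩
    · obtain ⟨L, P, hm⟩ := h
      exact ⟨L, P, hm, fun h => (hN h).elim⟩
  obtain ⟨S₀, hS₀⟩ := exists_modalCondition (M := ⟨True, _⟩) hm hslim
  obtain ⟨hdata, hant⟩ := Classical.epsilon_spec (p := IsModalData c d) ⟨(S₀, L, P), hS₀⟩
  exact ⟨⟨hdata.sub, hdata.le, fun hM => hdata.slim (hs hM)⟩, hant⟩

/-- The inference at a node is allowed by `M`. -/
structure Allowed (M : Mode) (t : SeqTree) (w : List Bool) : Prop where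
  noCut : M.noCut → ∀ A, t.ruleAt w ≠ some (.cut A)
  slim : M.slim → SlimAt t w

/-- The part of a tree up to the modal inferences that are the nearest to the root, if this part is
finite and contains no missing premises. -/
noncomputable def mainTree? (t : SeqTree) : Option (MainTree CutTerm) :=
  match t [] with
  | some (_, .impL A B) => do
    let l ← (t.sub [false]).mainTree?
    let r ← (t.sub [true]).mainTree?
    return .impL A B l r
  | some (_, .impR A B) => do
    let l ← (t.sub [false]).mainTree?
    return .impR A B l
  | some (_, .cut A) => do
    let l ← (t.sub [false]).mainTree?
    let r ← (t.sub [true]).mainTree?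
    return .cut A l r
  | some (c, .box A) => do
    let (S₀, L, P) := modalData c (← t.seqAt [false])
    return .box A S₀ L P (.leaf (t.sub [false]))
  | some (c, .boxPlus A) => do
    let (S₀, L, P) := modalData c (← t.seqAt [false])
    return .boxPlus A S₀ L P (.leaf (t.sub [false])) (.leaf (t.sub [true]))
  | some (_, .ax) => some .ax
  | none => none
partial_fixpoint

/-- The part of a tree up to the modal inferences that are the nearest to the root. -/
noncomputable def mainTree (t : SeqTree) : MainTree CutTerm := t.mainTree?.getD .ax

theorem IsProof.exists_mainTree? (ht : t.IsProof) : ∃ m, t.mainTree? = some m := by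
  refine IsProof.induction_not_isModal (P := fun t => ∃ m, t.mainTree? = some m)
    (fun t ht ih => ?_) ht
  obtain ⟨⟨c, r⟩, hc⟩ := Option.isSome_iff_exists.1 ht.root_mem
  have hchild (b : Bool) (d : Sequent) (hr : ¬ r.IsModal) (hd : t.seqAt [b] = some d) :
      ∃ m, (t.sub [b]).mainTree? = some m :=
    ih b r (ruleAt_nil_of_eq hc) hr (isSome_of_seqAt_eq hd)
  rw [mainTree?, hc]
  cases ht.rootStep hc with
  | ax => exact ⟨_, rfl⟩
  | impL _ hl hr | cut hl hr =>
    obtain ⟨l, hl⟩ := hchild _ _ id hl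
    obtain ⟨r, hr⟩ := hchild _ _ id hr
    simp [hl, hr]
  | impR _ hl =>
    obtain ⟨l, hl⟩ := hchild _ _ id hl
    simp [hl]
  | box _ _ hl | boxPlus _ _ hl => simp [hl]

theorem IsProof.mainTree?_sub (ht : t.IsProof) (hd : t.seqAt [b] = some d) :
    (t.sub [b]).mainTree? = some (t.sub [b]).mainTree := by
  obtain ⟨m, hm⟩ := (ht.sub (isSome_of_seqAt_eq hd)).exists_mainTree?
  rw [mainTree, hm, Option.getD_some]

section

variable {A B : Formula}

theorem mainTree_ax (hc : t [] = some (c, .ax)) : t.mainTree = .ax := by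
  rw [mainTree, mainTree?, hc]
  rfl

theorem IsProof.mainTree_impL (ht : t.IsProof) (hc : t [] = some (c, .impL A B)) :
    t.mainTree = .impL A B (t.sub [false]).mainTree (t.sub [true]).mainTree := by
  cases ht.rootStep hc with | impL _ hl hr => ?_
  rw [mainTree, mainTree?.eq_def, hc]
  simp [ht.mainTree?_sub hl, ht.mainTree?_sub hr]

theorem IsProof.mainTree_impR (ht : t.IsProof) (hc : t [] = some (c, .impR A B)) :
    t.mainTree = .impR A B (t.sub [false]).mainTree := by
  cases ht.rootStep hc with | impR _ hl => ?_
  rw [mainTree, mainTree?, hc]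
  simp [ht.mainTree?_sub hl]

theorem IsProof.mainTree_cut (ht : t.IsProof) (hc : t [] = some (c, .cut A)) :
    t.mainTree = .cut A (t.sub [false]).mainTree (t.sub [true]).mainTree := by
  cases ht.rootStep hc with | cut hl hr => ?_
  rw [mainTree, mainTree?, hc]
  simp [ht.mainTree?_sub hl, ht.mainTree?_sub hr]

theorem mainTree_box (hc : t [] = some (c, .box A)) (hd : t.seqAt [false] = some d) :
    t.mainTree = .box A (modalData c d).1 (modalData c d).2.1 (modalData c d).2.2
      (.leaf (t.sub [false])) := by
  rw [mainTree, mainTree?, hc]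
  simp [hd]

theorem mainTree_boxPlus (hc : t [] = some (c, .boxPlus A)) (hd : t.seqAt [false] = some d) :
    t.mainTree = .boxPlus A (modalData c d).1 (modalData c d).2.1 (modalData c d).2.2
      (.leaf (t.sub [false])) (.leaf (t.sub [true])) := by
  rw [mainTree, mainTree?, hc]
  simp [hd]

end

theorem Allowed.modalData_spec {Δ : Multiset Formula} (h : t.Allowed M []) (hc : t [] = some (c, r))
    (hr : r.IsModal) (hm : ∃ L P, ModalStep c.ctx c.ant Θ L P)
    (hd : t.seqAt [false] = some ⟨c.ctx, Θ, Δ⟩) :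
    ∃ S₀ L P, modalData c ⟨c.ctx, Θ, Δ⟩ = (S₀, L, P) ∧ ModalCondition M c.ctx c.ant S₀ L P ∧
      Θ = premAnt S₀ L P :=
  ⟨_, _, _, rfl, SeqTree.modalData_spec hm fun hM => h.slim hM c r _ hc hr hd⟩

theorem IsProof.derives_mainTree {ρ : PremiseRel CutTerm} (ht : t.IsProof) (ht' : t'.IsProof)
    (hc : t [] = some (c, r)) (hc' : t' [] = some (c, r)) (hM : t.Allowed M [])
    (hprem : r.IsModal → t'.seqAt [false] = t.seqAt [false])
    (hmodal : r.IsModal → ∀ b d, t.seqAt [b] = some d →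
      ρ (r.next none b) d (.leaf (t.sub [b])) (.leaf (t'.sub [b])))
    (hmain : ¬ r.IsModal → ∀ b d, t.seqAt [b] = some d →
      Derives M ρ d.ctx d.ant d.suc (t.sub [b]).mainTree (t'.sub [b]).mainTree) :
    Derives M ρ c.ctx c.ant c.suc t.mainTree t'.mainTree := by
  cases ht.rootStep hc with
  | ax h =>
    rw [mainTree_ax hc, mainTree_ax hc']
    exact .ax h
  | impL e hl hr =>
    rw [ht.mainTree_impL hc, ht'.mainTree_impL hc']
    exact .impL e (hmain id _ _ hl) (hmain id _ _ hr)
  | impR e hl =>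
    rw [ht.mainTree_impR hc, ht'.mainTree_impR hc']
    exact .impR e (hmain id _ _ hl)
  | cut hl hr =>
    rw [ht.mainTree_cut hc, ht'.mainTree_cut hc']
    exact .cut (fun h => hM.noCut h _ (ruleAt_nil_of_eq hc)) (hmain id _ _ hl) (hmain id _ _ hr)
  | box hm hA hl =>
    have hl' := (hprem trivial).trans hl
    obtain ⟨S₀, L, P, hdata, hcond, rfl⟩ := hM.modalData_spec hc trivial hm hl
    rw [mainTree_box hc hl, mainTree_box hc' hl', hdata]
    exact .box hcond hA (hmodal trivial _ _ hl)
  | boxPlus hm hA hl hr =>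
    have hl' := (hprem trivial).trans hl
    obtain ⟨S₀, L, P, hdata, hcond, rfl⟩ := hM.modalData_spec hc trivial hm hl
    rw [mainTree_boxPlus hc hl, mainTree_boxPlus hc' hl', hdata]
    exact .boxPlus hcond hA (hmodal trivial _ _ hl) (hmodal trivial _ _ hr)

end SeqTree

section Agree

variable {out : SeqTree → MainTree CutTerm} {M : Mode} {s : Annot} {k : ℕ∞} {c : Sequent}
  {t t' : CutTerm} {r : Rule} {b : Bool}

/-- `FragEq` for a possibly infinite index, which stands for the whole trees. -/
def Agree (out : SeqTree → MainTree CutTerm) (M : Mode) (s : Annot) (k : ℕ∞) : TermRel :=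
  fun c t t' => ∀ i : ℕ, (i : ℕ∞) ≤ k → FragEq out M (ProofEq out M) s i c t t'

/-- The condition on the finite trees at the roots of two trees that agree. -/
def HeadEq (out : SeqTree → MainTree CutTerm) (M : Mode) (s : Annot) (k : ℕ∞) (c : Sequent) :
    MainTree CutTerm → MainTree CutTerm → Prop :=
  Derives M (layer (ProofEq out M) (Agree out M s (k - 1)) s) c.ctx c.ant c.suc

theorem agree_zero : Agree out M s 0 c t t' := by
  intro i hi
  obtain rfl : i = 0 := by simpa using hi
  trivial

theorem agree_top : Agree out M s ⊤ = ProofEq out M := by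
  funext c t t'
  exact propext ⟨fun h => .of_fragEq s fun i => h i le_top, fun h i _ => h.le_fragEq _ _ _⟩

theorem agree_iff_headEq (hk : k ≠ 0) :
    Agree out M s k c t t' ↔ HeadEq out M s k c (t.head out) (t'.head out) := by
  have hk₁ : 1 ≤ k := Order.one_le_iff_ne_zero.2 hk
  have hle (i : ℕ) : (i : ℕ∞) ≤ k - 1 ↔ ((i + 1 : ℕ) : ℕ∞) ≤ k := by
    induction k with
    | top => simp
    | coe k => norm_cast at *; omega
  constructor
  · intro h
    have : Nonempty {i : ℕ // ((i + 1 : ℕ) : ℕ∞) ≤ k} := ⟨0, by simpa using hk₁⟩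
    refine (Derives.forall fun i : {i : ℕ // ((i + 1 : ℕ) : ℕ∞) ≤ k} => h (i.1 + 1) i.2).mono ?_
    intro a d x x' hx
    unfold layer at *
    split_ifs at * with ha
    · exact fun j hj => hx ⟨j, (hle j).1 hj⟩
    · exact hx this.some
  · rintro h (_ | i) hi
    · trivial
    · exact Derives.mono h (layer_mono le_rfl fun _ _ _ hx => hx i ((hle i).2 hi))

theorem agree_next :
    Agree out M (r.next s b) (r.level s b k) = Agree out M s (r.level s b k) := by
  by_cases h : r.Stays s b
  · rw [h.next_eq]
  · rw [Rule.level_of_not_stays h, agree_top, agree_top]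

theorem layer_next (hr : r.IsModal) :
    layer (ProofEq out M) (Agree out M s (k - 1)) s (r.next none b) =
      Agree out M s (r.level s b k) := by
  unfold layer
  split_ifs with h
  · rw [Rule.level_of_isModal_of_stays hr (Rule.stays_of_next_eq hr h.2 (h.2 ▸ h.1))]
  · have hs : ¬ r.Stays s b := fun hs => h ?_
    · rw [Rule.level_of_not_stays hs, agree_top]
    · obtain ⟨A, rfl, rfl, rfl⟩ := hs.eq_boxPlus hr
      exact ⟨Option.some_ne_none A, rfl⟩

end Agree

theorem not_frequently_lt_of_eventually_le {α : Type*} [LinearOrder α] [WellFoundedLT α]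
    {i : ℕ → α} (h : ∀ᶠ n in Filter.atTop, i (n + 1) ≤ i n) :
    ¬ ∃ᶠ n in Filter.atTop, i (n + 1) < i n := by
  obtain ⟨K, hK⟩ := Filter.eventually_atTop.1 h
  have hanti : AntitoneOn i (Set.Ici K) := antitoneOn_nat_Ici_of_succ_le hK
  obtain ⟨n, hn, hmin⟩ : ∃ n ∈ Set.Ici K, ∀ m ∈ Set.Ici K, i n ≤ i m :=
    ⟨_, Function.argminOn_mem i _ Set.nonempty_Ici, fun m => Function.argminOn_le i _⟩
  intro hlt
  obtain ⟨m, hnm, hm⟩ := Filter.frequently_atTop.1 hlt n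
  have hKm : K ≤ m := le_trans hn hnm
  exact ((hmin (m + 1) (Set.mem_Ici.2 (by omega))).trans_lt hm).not_ge (hanti hn hKm hnm)

namespace SeqTree

open Filter

variable {t t' : SeqTree} {M : Mode} {s : Annot} {k : ℕ∞} {c : Sequent} {r : Rule} {w : List Bool}
  {b : Bool}

theorem IsProof.agree_leaf (ht : t.IsProof) (ht' : t'.IsProof) (hc : t [] = some (c, r))
    (hc' : t' [] = some (c, r)) (hM : t.Allowed M []) (hk : k ≠ 0)
    (hprem : r.IsModal → t'.seqAt [false] = t.seqAt [false])
    (h : ∀ b d, t.seqAt [b] = some d →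
      Agree mainTree M s (r.level s b k) d (.leaf (t.sub [b])) (.leaf (t'.sub [b]))) :
    Agree mainTree M s k c (.leaf t) (.leaf t') := by
  refine (agree_iff_headEq hk).2 (ht.derives_mainTree ht' hc hc' hM hprem ?_ ?_)
  · intro hr b d hd
    rw [layer_next hr]
    exact h b d hd
  · intro hr b d hd
    have := h b d hd
    rw [Rule.level_of_not_isModal hr] at this
    exact (agree_iff_headEq hk).1 this

/-- A proof together with a fragment in which its term does not agree with itself. -/
structure Defect (M : Mode) where
  tree : SeqTree
  annot : Annot
  index : ℕ
  root : Sequent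
  isProof : tree.IsProof
  allowed : ∀ w, tree.Allowed M w
  seqAt_nil : tree.seqAt [] = some root
  not_fragEq : ¬ FragEq mainTree M (ProofEq mainTree M) annot index root (.leaf tree) (.leaf tree)

theorem Defect.exists_sub (σ : Defect M) : ∃ b, ∃ σ' : Defect M, σ'.tree = σ.tree.sub [b] ∧
    ∃ r, σ.tree.ruleAt [] = some r ∧ σ'.annot = r.next σ.annot b ∧
      (σ'.index : ℕ∞) ≤ r.level σ.annot b σ.index := by
  obtain ⟨⟨c, r⟩, hc, hroot⟩ := Option.map_eq_some_iff.1 σ.seqAt_nil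
  obtain rfl : c = σ.root := hroot
  have hindex : (σ.index : ℕ∞) ≠ 0 := fun h => σ.not_fragEq (agree_zero (M := M) _ h.le)
  by_contra! hn
  refine σ.not_fragEq (σ.isProof.agree_leaf σ.isProof hc hc (σ.allowed []) hindex (fun _ => rfl)
    (fun b d hd => ?_) σ.index le_rfl)
  rw [← agree_next]
  intro j hj
  by_contra hF
  exact hn b ⟨σ.tree.sub [b], r.next σ.annot b, j, d, σ.isProof.sub (isSome_of_seqAt_eq hd),
    fun w => ⟨(σ.allowed (b :: w)).noCut, (σ.allowed (b :: w)).slim⟩, hd, hF⟩ rfl r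
    (ruleAt_nil_of_eq hc) rfl |>.not_ge hj

theorem IsProof.proofEq_leaf (ht : t.IsProof) (hM : ∀ w, t.Allowed M w)
    (hc : t.seqAt [] = some c) : ProofEq mainTree M c (.leaf t) (.leaf t) := by
  refine .of_fragEq none fun i => ?_
  by_contra hF
  obtain ⟨f, σ, hσ, hsub⟩ := exists_path Defect.tree _ Defect.exists_sub
    (⟨t, none, i, c, ht, hM, hc, hF⟩ : Defect M)
  choose r hr hannot hindex using hσ
  have hrule (n : ℕ) : t.ruleAt (pathPrefix f n) = some (r n) := by
    rw [← hr, hsub, ruleAt, ruleAt, SeqTree.sub, List.append_nil]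
  obtain ⟨A, hstays, hmodal⟩ := hasGoodTail_iff.1
    (ht.branch f (isBranch_of_sub fun n => hsub n ▸ (σ n).isProof))
  replace hstays : ∀ᶠ n in atTop, (r n).Stays (some A) (f n) := hstays.mono fun n h => h _ (hrule n)
  replace hmodal : ∃ᶠ n in atTop, (r n).IsModal := hmodal.mono fun n ⟨r', hr', h⟩ => by
    rwa [Option.some.inj ((hrule n).symm.trans hr')]
  obtain ⟨K, hK⟩ : ∃ K, ∀ n ≥ K, (r n).Stays (σ n).annot (f n) := by
    obtain ⟨N, hN⟩ := eventually_atTop.1 hstays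
    obtain ⟨m, hm, hrm⟩ := frequently_atTop.1 hmodal N
    suffices ∀ n ≥ m + 1, (σ n).annot = some A from ⟨m + 1, fun n hn => this n hn ▸ hN n (by omega)⟩
    intro n hn
    induction n, hn using Nat.le_induction with
    | base =>
      obtain ⟨B, hB, hf, hBA⟩ := (hN m hm).eq_boxPlus hrm
      rw [hannot, hB, hf, hBA]
      rfl
    | succ n hn ih => rw [hannot, ih, (hN n (by omega)).next_eq]
  have hK' := eventually_atTop.2 ⟨K, hK⟩
  refine not_frequently_lt_of_eventually_le (i := fun n => (σ n).index)
    (hK'.mono fun n hn => Nat.cast_le.1 ((hindex n).trans hn.level_le))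
    ((hmodal.and_eventually hK').mono fun n ⟨hm, hn⟩ => ?_)
  have hne : (σ n).index ≠ 0 := fun h => (σ n).not_fragEq (h ▸ trivial)
  have := hindex n
  rw [Rule.level_of_isModal_of_stays hm hn] at this
  norm_cast at this
  omega

end SeqTree

section Levels

variable {t : SeqTree} {s : Annot} {n : ℕ} {b : Bool} {w : List Bool} {A : Formula}

theorem Rule.stays_iff {r : Rule} : r.Stays s b ↔
    (∀ A, r ≠ .box A) ∧ (∀ A, r = .boxPlus A → b ≠ false) ∧ r.next s b = s := by
  cases r with
  | boxPlus A => cases b <;> simp [Rule.Stays, Rule.next, eq_comm]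
  | _ => simp [Rule.Stays, Rule.next]

/-- `Rule.next` for the rule at the root of a tree. -/
def nextAnn (t : SeqTree) (s : Annot) (b : Bool) : Annot :=
  ((t.ruleAt []).map (Rule.next s b)).getD s

/-- `Rule.level` for the rule at the root of a tree. -/
noncomputable def SeqTree.childLevel (t : SeqTree) (s : Annot) (b : Bool) (k : ℕ∞) : ℕ∞ :=
  ((t.ruleAt []).map (Rule.level s b k)).getD k

theorem annAt_cons : annAt t s (b :: w) = annAt (t.sub [b]) (nextAnn t s b) w := rfl

theorem equivRoot_cons : EquivRoot t s (b :: w) ↔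
    (∀ r, t.ruleAt [] = some r → r.Stays s b) ∧ EquivRoot (t.sub [b]) s w := by
  have hroot : (∀ r, t.ruleAt [] = some r → r.Stays s b) ↔ (∀ A, t.ruleAt [] ≠ some (.box A)) ∧
      (∀ A, t.ruleAt [] = some (.boxPlus A) → b ≠ false) ∧ nextAnn t s b = s := by
    cases h : t.ruleAt [] <;> simp [nextAnn, h, Rule.stays_iff]
  rw [hroot]
  constructor
  · intro h
    have hb := h [] b ⟨w, rfl⟩
    refine ⟨hb, fun v b' hv => ?_⟩
    obtain ⟨hbox, hleft, hann⟩ := h (b :: v) b' ((List.prefix_cons_inj b).2 hv)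
    rw [List.cons_append, annAt_cons, show nextAnn t s b = s from hb.2.2] at hann
    exact ⟨hbox, hleft, hann⟩
  · rintro ⟨hb, h⟩ (_ | ⟨b', v⟩) b'' hv
    · obtain rfl : b'' = b := by simpa using hv
      exact hb
    · rw [List.cons_append, List.cons_prefix_cons] at hv
      obtain ⟨rfl, hv⟩ := hv
      rw [List.cons_append, annAt_cons, hb.2.2]
      exact h v b'' hv

theorem finite_boxPlus_prefixes (t : SeqTree) (w : List Bool) :
    {v : List Bool | v <+: w ∧ v ≠ w ∧ ∃ A, t.ruleAt v = some (Rule.boxPlus A)}.Finite :=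
  (List.finite_toSet w.inits).subset fun _ hv => (List.mem_inits _ _).2 hv.1

theorem boxPlusCount_nil : boxPlusCount t [] = 0 := by
  rw [boxPlusCount, Set.ncard_eq_zero (finite_boxPlus_prefixes t [])]
  exact Set.eq_empty_of_forall_notMem fun v hv => hv.2.1 (List.prefix_nil.1 hv.1)

theorem boxPlus_prefixes_cons (t : SeqTree) (b : Bool) (w : List Bool) :
    {v : List Bool | v <+: b :: w ∧ v ≠ b :: w ∧ ∃ A, t.ruleAt v = some (Rule.boxPlus A)} \ {[]} =
      List.cons b ''
        {v | v <+: w ∧ v ≠ w ∧ ∃ A, (t.sub [b]).ruleAt v = some (Rule.boxPlus A)} := by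
  ext v
  cases v with
  | nil => simp
  | cons b' v =>
    simp only [Set.mem_sdiff, Set.mem_ofPred_eq, List.cons_prefix_cons, Set.mem_singleton_iff,
      Set.mem_image, List.cons.injEq]
    constructor
    · rintro ⟨⟨⟨rfl, hv⟩, hne, hrule⟩, -⟩
      exact ⟨v, ⟨hv, fun h => hne (by rw [h]), hrule⟩, rfl, rfl⟩
    · rintro ⟨u, ⟨hv, hne, hrule⟩, rfl, rfl⟩
      exact ⟨⟨⟨rfl, hv⟩, fun h => hne (List.cons.inj h).2, hrule⟩, by simp⟩

theorem boxPlusCount_cons_of_ne (h : ∀ A, t.ruleAt [] ≠ some (.boxPlus A)) :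
    boxPlusCount t (b :: w) = boxPlusCount (t.sub [b]) w := by
  have := boxPlus_prefixes_cons t b w
  rw [Set.sdiff_singleton_eq_self (by simp [h])] at this
  rw [boxPlusCount, this, Set.ncard_image_of_injective _ List.cons_injective]
  rfl

theorem boxPlusCount_cons (h : t.ruleAt [] = some (.boxPlus A)) :
    boxPlusCount t (b :: w) = boxPlusCount (t.sub [b]) w + 1 := by
  have := congrArg Set.ncard (boxPlus_prefixes_cons t b w)
  rw [Set.ncard_image_of_injective _ List.cons_injective] at this
  rw [boxPlusCount, ← Set.ncard_sdiff_singleton_add_one (a := []) _ (finite_boxPlus_prefixes t _),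
    this]
  · rfl
  · exact ⟨List.nil_prefix, by simp, A, h⟩

theorem not_isLevelPremise_nil : ¬ IsLevelPremise t s n [] := by
  rintro ⟨⟨v, A, h, -⟩, -⟩
  simp at h

theorem exists_boxPlus_cons_eq_append_iff :
    (∃ v A, b :: w = v ++ [true] ∧ t.ruleAt v = some (.boxPlus A)) ↔
      (w = [] ∧ b = true ∧ ∃ A, t.ruleAt [] = some (.boxPlus A)) ∨
        ∃ v A, w = v ++ [true] ∧ (t.sub [b]).ruleAt v = some (.boxPlus A) := by
  constructor
  · rintro ⟨_ | ⟨b', v⟩, A, e, h⟩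
    · obtain ⟨rfl, rfl⟩ := List.cons.inj e
      exact .inl ⟨rfl, rfl, A, h⟩
    · obtain ⟨rfl, rfl⟩ := List.cons.inj e
      exact .inr ⟨v, A, rfl, h⟩
  · rintro (⟨rfl, rfl, A, h⟩ | ⟨v, A, rfl, h⟩)
    · exact ⟨[], A, rfl, h⟩
    · exact ⟨b :: v, A, rfl, h⟩

theorem isLevelPremise_cons (hn : n ≠ 0) : IsLevelPremise t s n (b :: w) ↔
    ∃ m : ℕ, t.childLevel s b n = m ∧ (w = [] ∧ m = 0 ∨ IsLevelPremise (t.sub [b]) s m w) := by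
  have hnil : EquivRoot (t.sub [b]) s [] := fun v b' hv => by simp at hv
  simp only [IsLevelPremise, exists_boxPlus_cons_eq_append_iff, equivRoot_cons,
    SeqTree.childLevel]
  by_cases hbox : ∃ A, t.ruleAt [] = some (.boxPlus A)
  · obtain ⟨A, hA⟩ := hbox
    rw [boxPlusCount_cons hA, hA]
    by_cases hs : (Rule.boxPlus A).Stays s b
    · obtain ⟨n, rfl⟩ := Nat.exists_eq_succ_of_ne_zero hn
      have hlevel : (Rule.boxPlus A).level s b (n.succ : ℕ) = n :=
        Rule.level_of_isModal_of_stays trivial hs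
      obtain rfl : b = true := hs.1
      simp only [Option.map_some, Option.getD_some, hlevel, Nat.cast_inj, exists_eq_left']
      by_cases hw : w = []
      · subst hw
        simp [hs, hnil, boxPlusCount_nil, @eq_comm ℕ 0]
      · simp [hs, hw]
    · simp [hs, Rule.level_of_not_stays hs]
  · push Not at hbox
    rw [boxPlusCount_cons_of_ne hbox]
    have hlevel (m : ℕ) : (n : ℕ∞) = m ↔ n = m := Nat.cast_inj
    cases h : t.ruleAt [] with
    | none => simp [hlevel, hn]
    | some r =>
      cases r with
      | box A => simp [Rule.Stays, Rule.level]
      | boxPlus A => exact (hbox A h).elim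
      | _ => simp [Rule.Stays, Rule.level, Rule.IsModal, hlevel, hn]

theorem inFragment_nil : InFragment t s n [] ↔ (t []).isSome := by
  refine and_iff_left fun v hv => ?_
  rw [List.prefix_nil.1 hv]
  exact not_isLevelPremise_nil

theorem inFragment_cons (hn : n ≠ 0) : InFragment t s n (b :: w) ↔
    (t (b :: w)).isSome ∧ t.childLevel s b n ≠ 0 ∧
      ∀ m : ℕ, t.childLevel s b n = m → InFragment (t.sub [b]) s m w := by
  have hprefix : (∀ v, v <+: b :: w → ¬ IsLevelPremise t s n v) ↔
      ∀ v, v <+: w → ¬ IsLevelPremise t s n (b :: v) := by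
    refine ⟨fun h v hv => h _ ((List.prefix_cons_inj b).2 hv), fun h v hv => ?_⟩
    cases v with
    | nil => exact not_isLevelPremise_nil
    | cons b' v =>
      obtain ⟨rfl, hv'⟩ := List.cons_prefix_cons.1 hv
      exact h v hv'
  rw [InFragment, hprefix]
  refine and_congr_right fun hw => ?_
  simp only [isLevelPremise_cons hn]
  constructor
  · refine fun h => ⟨fun h₀ => h [] List.nil_prefix ⟨0, h₀, .inl ⟨rfl, rfl⟩⟩, fun m hm => ?_⟩
    exact ⟨hw, fun v hv hl => h v hv ⟨m, hm, .inr hl⟩⟩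
  · rintro ⟨h₀, h⟩ v hv ⟨m, hm, ⟨-, rfl⟩ | hl⟩
    · exact h₀ hm
    · exact (h m hm).2 v hv hl

end Levels

namespace SeqTree

variable {t t' : SeqTree} {s : Annot} {n : ℕ} {k : ℕ∞} {b : Bool} {w : List Bool} {M : Mode}
  {c : Sequent}

/-- The labels of the `k`-fragment of the tree annotated with `s`. An infinite index stands for the
whole tree. -/
noncomputable def trunc : SeqTree → Annot → ℕ∞ → SeqTree
  | t, _, _, [] => t []
  | t, s, k, b :: w =>
    if t.childLevel s b k = 0 then none else (t.sub [b]).trunc s (t.childLevel s b k) w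

theorem trunc_cons (h : t.childLevel s b k ≠ 0) :
    t.trunc s k (b :: w) = (t.sub [b]).trunc s (t.childLevel s b k) w :=
  if_neg h

theorem childLevel_top : t.childLevel s b ⊤ = ⊤ := by
  cases h : t.ruleAt [] <;> simp [childLevel, h, Rule.level_top]

theorem trunc_top : t.trunc s ⊤ = t := by
  funext w
  induction w generalizing t with
  | nil => rfl
  | cons b w ih =>
    rw [trunc_cons (by simp [childLevel_top]), childLevel_top, ih]
    rfl

open Classical in
theorem trunc_eq (hn : n ≠ 0) : t.trunc s n w = if InFragment t s n w then t w else none := by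
  induction w generalizing t n with
  | nil =>
    by_cases h : (t []).isSome
    · rw [if_pos (inFragment_nil.2 h)]
      rfl
    · rw [if_neg (mt inFragment_nil.1 h)]
      exact Option.not_isSome_iff_eq_none.1 h
  | cons b w ih =>
    simp only [trunc, inFragment_cons hn]
    cases h : t.childLevel s b n with
    | top =>
      cases hw : t (b :: w) <;> simp [trunc_top, sub, hw]
    | coe m =>
      rcases eq_or_ne m 0 with rfl | hm
      · simp
      · have hiff : ((t (b :: w)).isSome ∧ (m : ℕ∞) ≠ 0 ∧ ∀ l : ℕ, (m : ℕ∞) = l →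
            InFragment (t.sub [b]) s l w) ↔ InFragment (t.sub [b]) s m w :=
          ⟨fun h => h.2.2 m rfl, fun h => ⟨h.1, by simpa using hm, fun l hl => by
            rwa [← Nat.cast_inj.1 hl]⟩⟩
        simp only [hiff, Nat.cast_eq_zero, hm, if_false, ih hm]
        rfl

theorem isSome_trunc (hn : n ≠ 0) : (t.trunc s n w).isSome ↔ InFragment t s n w := by
  classical
  rw [trunc_eq hn]
  split_ifs with h
  · exact iff_of_true h.1 h
  · exact iff_of_false (by simp) h

theorem fragment_eq (hn : n ≠ 0) :
    fragment t s n w = (t.trunc s n w).map fun l => (annAt t s w, l) := by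
  classical
  rw [trunc_eq hn, fragment]
  split_ifs <;> rfl

theorem ruleAt_nil_eq_of_trunc_eq (h : t.trunc s k = t'.trunc s k) :
    t.ruleAt [] = t'.ruleAt [] :=
  congrArg (Option.map Prod.snd) (congrFun h [])

theorem childLevel_eq_of_trunc_eq (h : t.trunc s k = t'.trunc s k) :
    t.childLevel s b k = t'.childLevel s b k := by
  rw [childLevel, childLevel, ruleAt_nil_eq_of_trunc_eq h]

theorem trunc_sub_eq_of_trunc_eq (h : t.trunc s k = t'.trunc s k) (hb : t.childLevel s b k ≠ 0) :
    (t.sub [b]).trunc s (t.childLevel s b k) = (t'.sub [b]).trunc s (t.childLevel s b k) := by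
  funext w
  have := congrFun h (b :: w)
  rwa [trunc_cons hb, trunc_cons (childLevel_eq_of_trunc_eq h ▸ hb),
    ← childLevel_eq_of_trunc_eq h] at this

theorem childLevel_of_ruleAt_eq {r : Rule} (h : t.ruleAt [] = some r) :
    t.childLevel s b k = r.level s b k := by
  rw [childLevel, h]
  rfl

theorem seqAt_left_eq_of_trunc_eq {r : Rule} (h : t.trunc s k = t'.trunc s k)
    (hr : t.ruleAt [] = some r) (hm : r.IsModal) : t'.seqAt [false] = t.seqAt [false] := by
  have hleft : t.childLevel s false k ≠ 0 := by
    rw [childLevel_of_ruleAt_eq hr, Rule.level_of_not_stays (Rule.not_stays_false hm)]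
    exact ENat.top_ne_zero
  have hsub := trunc_sub_eq_of_trunc_eq h hleft
  exact congrArg (Option.map Prod.fst) (congrFun hsub []).symm

theorem annAt_eq_of_trunc_eq (h : t.trunc s k = t'.trunc s k) (hw : (t.trunc s k w).isSome)
    (a : Annot) : annAt t a w = annAt t' a w := by
  induction w generalizing t t' k a with
  | nil => rfl
  | cons b w ih =>
    have hb : t.childLevel s b k ≠ 0 := fun hb => by simp [trunc, hb] at hw
    rw [trunc_cons hb] at hw
    rw [annAt_cons, annAt_cons, nextAnn, nextAnn, ← ruleAt_nil_eq_of_trunc_eq h]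
    exact ih (trunc_sub_eq_of_trunc_eq h hb) hw _

theorem fragment_eq_iff (hn : n ≠ 0) :
    fragment t s n = fragment t' s n ↔ t.trunc s n = t'.trunc s n := by
  constructor
  · intro h
    funext w
    have := congrArg (Option.map Prod.snd) (congrFun h w)
    simpa [fragment_eq hn, Option.map_map, Function.comp_def] using this
  · intro h
    funext w
    rw [fragment_eq hn, fragment_eq hn, ← h]
    cases e : t.trunc s n w with
    | none => rfl
    | some l =>
      rw [Option.map_some, Option.map_some, annAt_eq_of_trunc_eq h (by simp [e])]

theorem Allowed.of_isSome (h : (t w).isSome → t.Allowed M w) : t.Allowed M w := by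
  by_cases hw : (t w).isSome
  · exact h hw
  · have hw := Option.not_isSome_iff_eq_none.1 hw
    refine ⟨fun _ A => by simp [ruleAt, hw], fun _ c r p hc => ?_⟩
    cases hw.symm.trans hc

theorem Allowed.sub (h : t.Allowed M (b :: w)) : (t.sub [b]).Allowed M w := ⟨h.noCut, h.slim⟩

/-- The trees are `∞`-proofs with the same `k`-fragment, which contains only allowed inferences. -/
structure TruncEq (M : Mode) (s : Annot) (k : ℕ∞) (t t' : SeqTree) : Prop where
  isProof : t.IsProof
  isProof' : t'.IsProof
  trunc_eq : t.trunc s k = t'.trunc s k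
  allowed : ∀ w, (t.trunc s k w).isSome → t.Allowed M w

theorem TruncEq.sub (h : TruncEq M s k t t') (hb : t.childLevel s b k ≠ 0) (hs : (t [b]).isSome) :
    TruncEq M s (t.childLevel s b k) (t.sub [b]) (t'.sub [b]) := by
  have hsub := trunc_sub_eq_of_trunc_eq h.trunc_eq hb
  refine ⟨h.isProof.sub hs, h.isProof'.sub ?_, hsub, fun w hw => (h.allowed (b :: w) ?_).sub⟩
  · have := congrFun hsub []
    change t [b] = t' [b] at this
    exact this ▸ hs
  · rwa [trunc_cons hb]

theorem TruncEq.agree_leaf_top (h : TruncEq M s ⊤ t t') (hc : t.seqAt [] = some c) :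
    Agree mainTree M s ⊤ c (.leaf t) (.leaf t') := by
  obtain rfl : t = t' := by simpa only [trunc_top] using h.trunc_eq
  rw [agree_top]
  exact h.isProof.proofEq_leaf (fun w => .of_isSome fun hw => h.allowed w (by rwa [trunc_top])) hc

/-- Below the modal inferences the index is constant, and it decreases at the right premises of `□⁺`
that retain the annotation. -/
theorem TruncEq.agree_leaf (h : TruncEq M s k t t') (hc : t.seqAt [] = some c) :
    Agree mainTree M s k c (.leaf t) (.leaf t') := by
  cases k with | top => exact h.agree_leaf_top hc | coe n => ?_
  induction n generalizing t t' c with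
  | zero => exact agree_zero
  | succ n ih =>
    refine IsProof.induction_not_isModal (P := fun t => ∀ {t' c}, TruncEq M s (n + 1 : ℕ) t t' →
      t.seqAt [] = some c → Agree mainTree M s (n + 1 : ℕ) c (.leaf t) (.leaf t'))
      (fun t ht ih' t' c h hc => ?_) h.isProof h hc
    obtain ⟨⟨c, r⟩, hcr, rfl⟩ := Option.map_eq_some_iff.1 hc
    have hlevel (b : Bool) := childLevel_of_ruleAt_eq (s := s) (b := b) (k := (n + 1 : ℕ))
      (ruleAt_nil_of_eq hcr)
    have hcr' : t' [] = some (c, r) := (congrFun h.trunc_eq []).symm.trans hcr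
    refine ht.agree_leaf h.isProof' hcr hcr' (h.allowed [] (by simp [trunc, hcr])) (by simp)
      (seqAt_left_eq_of_trunc_eq h.trunc_eq (ruleAt_nil_of_eq hcr)) fun b d hd => ?_
    by_cases h₀ : t.childLevel s b (n + 1 : ℕ) = 0
    · rw [← hlevel, h₀]
      exact agree_zero
    have hsub := h.sub h₀ (isSome_of_seqAt_eq hd)
    rw [hlevel] at hsub
    by_cases hr : r.IsModal
    · by_cases hs : r.Stays s b
      · rw [Rule.level_of_isModal_of_stays hr hs] at *
        exact ih hd hsub
      · rw [Rule.level_of_not_stays hs] at *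
        exact hsub.agree_leaf_top hd
    · rw [Rule.level_of_not_isModal hr] at *
      exact ih' b r (ruleAt_nil_of_eq hcr) hr (isSome_of_seqAt_eq hd) hsub hd

end SeqTree

namespace MainTree

/-- The last rule of a tree. -/
def rule {X : Type} : MainTree X → Rule
  | .ax => .ax
  | .impL A B _ _ => .impL A B
  | .impR A B _ => .impR A B
  | .cut A _ _ => .cut A
  | .box A _ _ _ _ => .box A
  | .boxPlus A _ _ _ _ _ => .boxPlus A

/-- The premises of the last inference of a derivation of the sequent `c`, together with their
derivations. The left or only premise is given by `false`, and the right one is given by `true`. -/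
noncomputable def child (out : SeqTree → MainTree CutTerm) (c : Sequent) :
    MainTree CutTerm → Bool → Option (Sequent × MainTree CutTerm)
  | .impL A B l _, false => some (⟨c.ctx, B ::ₘ c.ant.erase (.imp A B), c.suc⟩, l)
  | .impL A B _ r, true => some (⟨c.ctx, c.ant.erase (.imp A B), A ::ₘ c.suc⟩, r)
  | .impR A B t, false => some (⟨c.ctx, A ::ₘ c.ant, B ::ₘ c.suc.erase (.imp A B)⟩, t)
  | .cut A l _, false => some (⟨c.ctx, c.ant, A ::ₘ c.suc⟩, l)
  | .cut A _ r, true => some (⟨c.ctx, A ::ₘ c.ant, c.suc⟩, r)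
  | .box A S₀ L P x, false => some (⟨c.ctx, premAnt S₀ L P, {A}⟩, x.head out)
  | .boxPlus A S₀ L P x _, false => some (⟨c.ctx, premAnt S₀ L P, {A}⟩, x.head out)
  | .boxPlus A S₀ L P _ y, true => some (⟨c.ctx, premAnt S₀ L P, {Formula.boxPlus A}⟩, y.head out)
  | _, _ => none

/-- The possibly infinite tree of a derivation of the sequent `c`. -/
noncomputable def render (out : SeqTree → MainTree CutTerm) :
    Sequent → MainTree CutTerm → SeqTree
  | c, m, [] => some (c, m.rule)
  | c, m, b :: w => (m.child out c b).bind fun p => p.2.render out p.1 w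

end MainTree

/-- The relation between corresponding premises of the last inferences, by the rule `r`, of two
related derivations. -/
inductive ChildRel (out : SeqTree → MainTree CutTerm) (M : Mode) (ρ : PremiseRel CutTerm) (r : Rule)
    (b : Bool) : Sequent × MainTree CutTerm → Sequent × MainTree CutTerm → Prop
  | main {d : Sequent} {p p' : MainTree CutTerm} (hr : ¬ r.IsModal)
      (h : Derives M ρ d.ctx d.ant d.suc p p') : ChildRel out M ρ r b (d, p) (d, p')
  | modal {d : Sequent} {x x' : CutTerm} (hr : r.IsModal) (h : ρ (r.next none b) d x x') :
      ChildRel out M ρ r b (d, x.head out) (d, x'.head out)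

section Render

open MainTree

variable {out : SeqTree → MainTree CutTerm} {M : Mode} {ρ : PremiseRel CutTerm} {c d : Sequent}
  {m m' p : MainTree CutTerm} {s : Annot} {k : ℕ∞} {t t' : CutTerm} {b : Bool} {w : List Bool}
  {f : ℕ → Bool} {n : ℕ}

theorem Derives.rule_eq (h : Derives M ρ c.ctx c.ant c.suc m m') : m.rule = m'.rule := by
  cases h <;> rfl

theorem Derives.child (h : Derives M ρ c.ctx c.ant c.suc m m') (b : Bool) :
    Option.Rel (ChildRel out M ρ m.rule b) (m.child out c b) (m'.child out c b) := by
  cases h with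
  | ax h => cases b <;> exact .none
  | impL e hl hr =>
    cases b
    · exact .some (.main id (by simpa [e] using hl))
    · exact .some (.main id (by simpa [e] using hr))
  | impR e h =>
    cases b
    · exact .some (.main id (by simpa [e] using h))
    · exact .none
  | cut hM hl hr =>
    cases b
    · exact .some (.main id hl)
    · exact .some (.main id hr)
  | box hm hA hx =>
    cases b
    · exact .some (.modal trivial hx)
    · exact .none
  | boxPlus hm hA hx hy =>
    cases b
    · exact .some (.modal trivial hx)
    · exact .some (.modal trivial hy)

theorem HeadEq.child (h : HeadEq out M s k c m m') (b : Bool) :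
    Option.Rel (fun p p' => p.1 = p'.1 ∧
        (m.rule.level s b k ≠ 0 → HeadEq out M s (m.rule.level s b k) p.1 p.2 p'.2))
      (m.child out c b) (m'.child out c b) := by
  have := Derives.child (out := out) h b
  generalize m.child out c b = p, m'.child out c b = p' at this
  cases this with
  | none => exact .none
  | some hp =>
    cases hp with
    | main hr hp => exact .some ⟨rfl, fun _ => by rwa [Rule.level_of_not_isModal hr]⟩
    | modal hr hx =>
      rw [layer_next hr] at hx
      exact .some ⟨rfl, fun h₀ => (agree_iff_headEq h₀).1 hx⟩

theorem render_ruleAt_nil : (m.render out c).ruleAt [] = some m.rule := by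
  rw [SeqTree.ruleAt, render]
  rfl

theorem render_seqAt_nil : (m.render out c).seqAt [] = some c := by
  rw [SeqTree.seqAt, render]
  rfl

theorem render_sub_some (h : m.child out c b = some (d, p)) :
    (m.render out c).sub [b] = p.render out d := by
  funext w
  rw [SeqTree.sub, List.singleton_append, render, h]
  rfl

theorem render_sub_none (h : m.child out c b = none) :
    (m.render out c).sub [b] = fun _ => none := by
  funext w
  rw [SeqTree.sub, List.singleton_append, render, h]
  rfl

theorem render_seqAt_singleton :
    (m.render out c).seqAt [b] = (m.child out c b).map Prod.fst := by
  change ((m.render out c).sub [b]).seqAt [] = _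
  cases h : m.child out c b with
  | none => rw [render_sub_none h]; rfl
  | some p => rw [render_sub_some h, render_seqAt_nil]; rfl

theorem HeadEq.trunc_render_eq (h : HeadEq out M s k c m m') :
    (m.render out c).trunc s k = (m'.render out c).trunc s k := by
  funext w
  induction w generalizing c m m' k with
  | nil => rw [SeqTree.trunc, SeqTree.trunc, render, render, Derives.rule_eq h]
  | cons b w ih =>
    have hl := SeqTree.childLevel_of_ruleAt_eq (s := s) (b := b) (k := k)
      (render_ruleAt_nil (out := out) (c := c) (m := m))
    have hl' := SeqTree.childLevel_of_ruleAt_eq (s := s) (b := b) (k := k)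
      (render_ruleAt_nil (out := out) (c := c) (m := m'))
    rw [← Derives.rule_eq h] at hl'
    rw [SeqTree.trunc, SeqTree.trunc, hl, hl']
    split_ifs with h₀
    · rfl
    have hchild := h.child b
    generalize e : m.child out c b = p, e' : m'.child out c b = p' at hchild
    cases hchild with
    | none => rw [render_sub_none e, render_sub_none e']
    | @some p p' hp =>
      obtain ⟨d, p⟩ := p
      obtain ⟨d', p'⟩ := p'
      obtain ⟨rfl, hp⟩ := hp
      rw [render_sub_some e, render_sub_some e']
      exact ih (hp h₀)

theorem ModalCondition.modalStep {S : Set Formula} {Γ : Multiset Formula} {S₀ : Finset Formula}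
    {L P : Multiset Formula} (h : ModalCondition M S Γ S₀ L P) :
    ModalStep S Γ (premAnt S₀ L P) L P := by
  refine ⟨Γ - boxedAnt L P, S₀, h.sub, ?_, rfl⟩
  rw [add_assoc]
  exact (tsub_add_cancel_of_le h.le).symm

theorem Derives.allowed_nil (h : Derives M ρ c.ctx c.ant c.suc m m') :
    (m.render out c).Allowed M [] := by
  refine ⟨fun hM A => ?_, fun hM d r p hd hr hp => ?_⟩
  · rw [render_ruleAt_nil]
    cases h with
    | cut hN => exact absurd hM hN
    | _ => simp [rule]
  · rw [render] at hd
    cases hd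
    rw [List.nil_append, render_seqAt_singleton] at hp
    cases h with
    | box hm | boxPlus hm =>
      cases hp
      exact ⟨_, _, (hm.slim hM).1, (hm.slim hM).2, hm.modalStep⟩
    | _ => exact hr.elim

theorem HeadEq.allowed (h : HeadEq out M s k c m m')
    (hw : ((m.render out c).trunc s k w).isSome) : (m.render out c).Allowed M w := by
  induction w generalizing c m m' k with
  | nil => exact Derives.allowed_nil h
  | cons b w ih =>
    have hl := SeqTree.childLevel_of_ruleAt_eq (s := s) (b := b) (k := k)
      (render_ruleAt_nil (out := out) (c := c) (m := m))
    rw [SeqTree.trunc, hl] at hw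
    split_ifs at hw with h₀
    · cases hw
    suffices ((m.render out c).sub [b]).Allowed M w from ⟨this.noCut, this.slim⟩
    have hchild := h.child b
    generalize e : m.child out c b = p, m'.child out c b = p' at hchild
    cases hchild with
    | none =>
      rw [render_sub_none e]
      exact .of_isSome fun h => by cases h
    | @some p p' hp =>
      rw [render_sub_some e] at hw ⊢
      exact ih (hp.2 h₀) hw

theorem Derives.inference (h : Derives M ρ c.ctx c.ant c.suc m m') :
    ∃ ps : List Sequent, Inference c m.rule ps ∧
      ∀ b : Bool, (m.child out c b).map Prod.fst = ps[b.toNat]? := by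
  obtain ⟨S, Γ, Δ⟩ := c
  cases h with
  | ax h =>
    refine ⟨[], ?_, by rintro (_ | _) <;> rfl⟩
    rcases h with h | ⟨p, h₁, h₂⟩
    · obtain ⟨Γ, rfl⟩ := Multiset.exists_cons_of_mem h
      exact .axBot S Γ Δ
    · obtain ⟨Γ, rfl⟩ := Multiset.exists_cons_of_mem h₁
      obtain ⟨Δ, rfl⟩ := Multiset.exists_cons_of_mem h₂
      exact .axVar S Γ Δ p
  | impL e hl hr =>
    obtain rfl := e
    exact ⟨_, .impL S _ Δ _ _, by rintro (_ | _) <;> simp [MainTree.child]⟩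
  | impR e hl =>
    obtain rfl := e
    exact ⟨_, .impR S Γ _ _ _, by rintro (_ | _) <;> simp [MainTree.child]⟩
  | cut hM hl hr => exact ⟨_, .cut S Γ Δ _, by rintro (_ | _) <;> rfl⟩
  | box hm hA hx =>
    obtain ⟨Δ, rfl⟩ := Multiset.exists_cons_of_mem hA
    exact ⟨_, .box S Γ _ _ _ Δ _ hm.modalStep, by rintro (_ | _) <;> rfl⟩
  | boxPlus hm hA hx hy =>
    obtain ⟨Δ, rfl⟩ := Multiset.exists_cons_of_mem hA
    exact ⟨_, .boxPlus S Γ _ _ _ Δ _ hm.modalStep, by rintro (_ | _) <;> rfl⟩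

theorem exists_child_of_isBranch (hf : (m.render out c).IsBranch f) :
    ∃ d p, m.child out c (f 0) = some (d, p) ∧ (p.render out d).IsBranch fun i => f (1 + i) := by
  have hsub : ((m.render out c).sub [f 0]).IsBranch fun i => f (1 + i) := hf.sub 1
  cases h : m.child out c (f 0) with
  | none => cases render_sub_none h ▸ hsub 0
  | some p => exact ⟨p.1, p.2, rfl, render_sub_some h ▸ hsub⟩

theorem exists_isModal_of_isBranch (hf : (m.render out c).IsBranch f) :
    ∃ n r, (m.render out c).ruleAt (pathPrefix f n) = some r ∧ r.IsModal := by
  have hchild {c : Sequent} {m : MainTree CutTerm} {f : ℕ → Bool}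
      (hf : (m.render out c).IsBranch f) (h : ∀ d p, m.child out c (f 0) = some (d, p) →
        ∀ {g}, (p.render out d).IsBranch g →
          ∃ n r, (p.render out d).ruleAt (pathPrefix g n) = some r ∧ r.IsModal) :
      ∃ n r, (m.render out c).ruleAt (pathPrefix f n) = some r ∧ r.IsModal := by
    obtain ⟨d, p, hp, hbranch⟩ := exists_child_of_isBranch hf
    obtain ⟨n, r, hr⟩ := h d p hp hbranch
    refine ⟨1 + n, r, ?_⟩
    rw [← render_sub_some hp] at hr
    rwa [pathPrefix_add]
  induction m generalizing c f with
  | box | boxPlus => exact ⟨0, _, render_ruleAt_nil, trivial⟩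
  | ax => exact hchild hf fun d p hp => by cases f 0 <;> cases hp
  | impR _ _ _ ih =>
    refine hchild hf fun d p hp _ hg => ?_
    cases hf₀ : f 0 <;> rw [hf₀] at hp <;> cases hp
    exact ih hg
  | impL _ _ _ _ ihl ihr | cut _ _ _ ihl ihr =>
    refine hchild hf fun d p hp _ hg => ?_
    cases hf₀ : f 0 <;> rw [hf₀] at hp <;> cases hp
    · exact ihl hg
    · exact ihr hg

theorem sub_succ_render (h : (m.render out c).sub (pathPrefix f n) = p.render out d) :
    (m.render out c).sub (pathPrefix f (n + 1)) = (p.render out d).sub [f n] := by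
  rw [← h, pathPrefix_succ]
  funext w
  exact congrArg _ (List.append_assoc _ _ _)

theorem hasGoodTail_render {Q : Sequent → MainTree CutTerm → Prop}
    (hQ : ∀ b c d m p, Q c m → m.child out c b = some (d, p) → m.rule.Stays s b ∧ Q d p ∨
      ∀ g, (p.render out d).IsBranch g → (p.render out d).HasGoodTail g)
    (hm : Q c m) (hf : (m.render out c).IsBranch f) : (m.render out c).HasGoodTail f := by
  by_contra hbad
  have hstep (n : ℕ) (d : Sequent) (p : MainTree CutTerm) (hp : Q d p)
      (e : (m.render out c).sub (pathPrefix f n) = p.render out d) :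
      p.rule.Stays s (f n) ∧ ∃ d' p', Q d' p' ∧
        (m.render out c).sub (pathPrefix f (n + 1)) = p'.render out d' := by
    obtain ⟨d', p', hp', -⟩ := exists_child_of_isBranch (e ▸ hf.sub n)
    have e' := (sub_succ_render e).trans (render_sub_some hp')
    obtain ⟨hs, hq⟩ | hgood := hQ _ _ _ _ _ hp hp'
    · exact ⟨hs, d', p', hq, e'⟩
    · exact (hbad (SeqTree.hasGoodTail_sub_iff.1 (e' ▸ hgood _ (e' ▸ hf.sub (n + 1))))).elim
  have hsub (n : ℕ) : ∃ d p, Q d p ∧ (m.render out c).sub (pathPrefix f n) = p.render out d := by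
    induction n with
    | zero => exact ⟨c, m, hm, rfl⟩
    | succ n ih =>
      obtain ⟨d, p, hp, e⟩ := ih
      exact (hstep n d p hp e).2
  refine hbad (.of_stays (s := s) (fun n r hr => ?_) fun n => ?_)
  · obtain ⟨d, p, hp, e⟩ := hsub n
    rw [← SeqTree.ruleAt_sub_nil, e, render_ruleAt_nil] at hr
    obtain rfl := Option.some.inj hr
    exact (hstep n d p hp e).1
  · obtain ⟨d, p, -, e⟩ := hsub n
    obtain ⟨i, r, hr, hm⟩ := exists_isModal_of_isBranch (e ▸ hf.sub n)
    refine ⟨i, r, ?_, hm⟩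
    rw [← e] at hr
    rwa [pathPrefix_add]

theorem ProofEq.hasGoodTail_render (h : ProofEq out M c t t')
    (hf : ((t.head out).render out c).IsBranch f) :
    ((t.head out).render out c).HasGoodTail f := by
  let X : TermRel := fun c t _ => ∀ f, ((t.head out).render out c).IsBranch f →
    ((t.head out).render out c).HasGoodTail f
  suffices ProofEq out M ≤ X from this _ _ _ h f hf
  refine le_of_fragEq_le fun s c t t' h f hf => ?_
  let Y : TermRel := fun c t t' => ∀ i, FragEq out M (ProofEq out M ⊓ X) s i c t t'
  have hY {c t t'} (h : Y c t t') : Derives M (layer (ProofEq out M ⊓ X) Y s) c.ctx c.ant c.suc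
      (t.head out) (t'.head out) := by
    refine (Derives.forall fun i => h (i + 1)).mono fun a d x x' hx => ?_
    by_cases ha : a ≠ none ∧ a = s
    · simpa only [layer, if_pos ha] using hx
    · simpa only [layer, if_neg ha] using hx 0
  refine _root_.hasGoodTail_render (s := s) (Q := fun d p =>
    ∃ p', Derives M (layer (ProofEq out M ⊓ X) Y s) d.ctx d.ant d.suc p p') ?_ ⟨_, hY h⟩ hf
  rintro b c d m p ⟨m', hm⟩ hp
  have hchild := Derives.child (out := out) hm b
  rw [hp] at hchild
  generalize m'.child out c b = q at hchild
  cases hchild with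
  | some h =>
    cases h with
    | main hr h => exact .inl ⟨Rule.stays_of_not_isModal hr, _, h⟩
    | modal hr h =>
      unfold layer at h
      split_ifs at h with ha
      · exact .inl ⟨Rule.stays_of_next_eq hr ha.2 (ha.2 ▸ ha.1), _, hY h⟩
      · exact .inr h.2

theorem Derives.render_sub
    (h : Derives M (fun _ => ProofEq out M) c.ctx c.ant c.suc m m') (w : List Bool) :
    (m.render out c).sub w = (fun _ => none) ∨ ∃ d p p', (m.render out c).sub w = p.render out d ∧
      Derives M (fun _ => ProofEq out M) d.ctx d.ant d.suc p p' := by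
  induction w generalizing c m m' with
  | nil => exact .inr ⟨c, m, m', rfl, h⟩
  | cons b w ih =>
    have hsub : (m.render out c).sub (b :: w) = ((m.render out c).sub [b]).sub w := rfl
    have hchild := Derives.child (out := out) h b
    generalize e : m.child out c b = p, m'.child out c b = p' at hchild
    rw [hsub]
    cases hchild with
    | none =>
      rw [render_sub_none e]
      exact .inl rfl
    | some hp =>
      rw [render_sub_some e]
      cases hp with
      | main _ hp => exact ih hp
      | modal _ hx => exact ih hx.derives

theorem ProofEq.isProof (h : ProofEq out M c t t') : ((t.head out).render out c).IsProof where
  root_mem := by rw [render]; rfl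
  closed w b hw := by
    obtain e | ⟨d, p, p', e, -⟩ := h.derives.render_sub w
    · exact congrFun e [b]
    · have := congrFun e []
      rw [SeqTree.sub, List.append_nil, hw, render] at this
      cases this
  step w d r hw := by
    have hnil : (t.head out).render out c w = ((t.head out).render out c).sub w [] := by
      rw [SeqTree.sub, List.append_nil]
    rw [hnil] at hw
    obtain e | ⟨d, p, p', e, hp⟩ := h.derives.render_sub w
    · rw [e] at hw
      cases hw
    · rw [e, render] at hw
      cases hw
      obtain ⟨ps, hps, hchild⟩ := Derives.inference (out := out) hp
      refine ⟨ps, hps, fun b => ?_⟩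
      rw [← hchild b, ← render_seqAt_singleton, ← e]
      rfl
  branch _ := h.hasGoodTail_render

end Render

section Operation

open SeqTree MainTree

variable {A : Formula} {c : Sequent} {π τ π' τ' : InfProof} {M : Mode} {s : Annot} {i : ℕ}

theorem InfProof.seqAt_nil (π : InfProof) : π.tree.seqAt [] = some π.root := by
  rw [seqAt, root, ← Option.map_some, Option.some_get]

theorem InfProof.root_eq (h : π.tree.seqAt [] = some c) : π.root = c :=
  Option.some.inj (π.seqAt_nil.symm.trans h)

/-- The main tree of the result of the elimination of a cut with the conclusion `c`. -/
noncomputable def cutHead (A : Formula) (c : Sequent) (π τ : InfProof) : MainTree CutTerm :=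
  CutTerm.head mainTree (.elim A c.suc (.leaf π.tree) (.leaf τ.tree))

theorem InfProof.proofEq_leaf (π : InfProof) :
    ProofEq mainTree ⟨False, False⟩ π.root (.leaf π.tree) (.leaf π.tree) :=
  (IsProof.of_infProof π).proofEq_leaf (fun _ => ⟨False.elim, False.elim⟩) π.seqAt_nil

theorem IsCutPair.isProof (h : IsCutPair A c π τ) :
    ((cutHead A c π τ).render mainTree c).IsProof := by
  have hπ := π.proofEq_leaf
  have hτ := τ.proofEq_leaf
  rw [h.1] at hπ
  rw [h.2] at hτ
  exact (CutEliminable.elim_proofEq (cutEliminable A) hπ hτ).isProof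

open Classical in
/-- The operation that removes cuts with the cut formula `A`. Its value is the first proof if the
arguments are not the premises of such a cut. -/
noncomputable def removeCut (A : Formula) (π τ : InfProof) : InfProof :=
  if h : ∃ c, IsCutPair A c π τ then h.choose_spec.isProof.toInfProof else π

theorem IsCutPair.unique {c' : Sequent} (h : IsCutPair A c π τ) (h' : IsCutPair A c' π τ) :
    c = c' := by
  have h₁ := h.1.symm.trans h'.1
  have h₂ := h.2.symm.trans h'.2
  simp only [Sequent.mk.injEq] at h₁ h₂
  exact Sequent.ext h₁.1 h₁.2.1 h₂.2.2

theorem IsCutPair.removeCut_tree (h : IsCutPair A c π τ) :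
    (removeCut A π τ).tree = (cutHead A c π τ).render mainTree c := by
  have h' : ∃ c, IsCutPair A c π τ := ⟨c, h⟩
  rw [removeCut, dif_pos h', h.unique h'.choose_spec]
  rfl

theorem IsCutPair.removeCut_root (h : IsCutPair A c π τ) : (removeCut A π τ).root = c :=
  InfProof.root_eq (h.removeCut_tree ▸ render_seqAt_nil)

theorem removeCut_of_not_isCutPair (h : ¬ ∃ c, IsCutPair A c π τ) : removeCut A π τ = π :=
  dif_neg h

theorem isBinaryOperation_removeCut (A : Formula) : IsBinaryOperation (removeCut A) := by
  intro π τ s hs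
  by_cases h : ∃ c, IsCutPair A c π τ
  · obtain ⟨c, h⟩ := h
    have hτ := hs.2
    rw [InfProof.Ann, h.2] at hτ
    rwa [InfProof.Ann, h.removeCut_root]
  · rw [removeCut_of_not_isCutPair h]
    exact hs.1

theorem isRemoving_removeCut (A : Formula) : IsRemoving A (removeCut A) :=
  ⟨isBinaryOperation_removeCut A, fun _ _ _ h => h.removeCut_root⟩

theorem IsCutPair.headEq_cutHead (h : IsCutPair A c π τ) (hs : s ∈ τ.Ann) (hi : i ≠ 0)
    (hπ : TruncEq M s i π.tree π'.tree) (hτ : TruncEq M s i τ.tree τ'.tree) :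
    HeadEq mainTree M s i c (cutHead A c π τ) (cutHead A c π' τ') := by
  have hπ' := hπ.agree_leaf π.seqAt_nil
  have hτ' := hτ.agree_leaf τ.seqAt_nil
  rw [h.1] at hπ'
  rw [h.2] at hτ'
  rw [InfProof.Ann, h.2] at hs
  exact (agree_iff_headEq (by simpa using hi)).1 fun j hj =>
    CutEliminable.elim_fragEq (cutEliminable A) hs (hπ' j hj) (hτ' j hj)

theorem allowed_removeCut (hs : s ∈ τ.Ann) (hi : i ≠ 0)
    (hπ : ∀ w, InFragment π.tree s i w → π.tree.Allowed M w)
    (hτ : ∀ w, InFragment τ.tree s i w → τ.tree.Allowed M w) {w : List Bool}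
    (hw : InFragment (removeCut A π τ).tree s i w) : (removeCut A π τ).tree.Allowed M w := by
  by_cases h : ∃ c, IsCutPair A c π τ
  · obtain ⟨c, h⟩ := h
    rw [h.removeCut_tree] at hw ⊢
    simp only [← isSome_trunc hi] at hπ hτ hw
    have hπ := TruncEq.mk (.of_infProof π) (.of_infProof π) rfl hπ
    have hτ := TruncEq.mk (.of_infProof τ) (.of_infProof τ) rfl hτ
    exact (h.headEq_cutHead hs hi hπ hτ).allowed hw
  · rw [removeCut_of_not_isCutPair h] at hw ⊢
    exact hπ w hw

theorem InfProof.root_eq_of_fragment_eq (hi : i ≠ 0)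
    (h : fragment π.tree s i = fragment π'.tree s i) : π.root = π'.root := by
  refine InfProof.root_eq (Eq.trans ?_ π'.seqAt_nil)
  exact congrArg (Option.map Prod.fst) (congrFun ((fragment_eq_iff hi).1 h) [])

theorem truncEq_of_fragment_eq (hi : i ≠ 0) (h : fragment π.tree s i = fragment π'.tree s i) :
    TruncEq ⟨False, False⟩ s i π.tree π'.tree :=
  ⟨.of_infProof π, .of_infProof π', (fragment_eq_iff hi).1 h, fun _ _ => ⟨False.elim, False.elim⟩⟩

theorem fragment_removeCut_eq (hs : s ∈ τ.Ann) (hi : i ≠ 0)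
    (hπ : fragment π.tree s i = fragment π'.tree s i)
    (hτ : fragment τ.tree s i = fragment τ'.tree s i) :
    fragment (removeCut A π τ).tree s i = fragment (removeCut A π' τ').tree s i := by
  have hpair (c : Sequent) : IsCutPair A c π τ ↔ IsCutPair A c π' τ' := by
    rw [IsCutPair, IsCutPair, InfProof.root_eq_of_fragment_eq hi hπ,
      InfProof.root_eq_of_fragment_eq hi hτ]
  by_cases h : ∃ c, IsCutPair A c π τ
  · obtain ⟨c, h⟩ := h
    rw [h.removeCut_tree, ((hpair c).1 h).removeCut_tree, fragment_eq_iff hi]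
    exact (h.headEq_cutHead hs hi (truncEq_of_fragment_eq hi hπ)
      (truncEq_of_fragment_eq hi hτ)).trunc_render_eq
  · rwa [removeCut_of_not_isCutPair h, removeCut_of_not_isCutPair (by simpa only [hpair] using h)]

theorem nonExpansive_removeCut (A : Formula) : NonExpansive (removeCut A) := by
  rintro s i π τ π' τ' ⟨hπ, hπ', hfragπ⟩ ⟨hτ, hτ', hfragτ⟩
  exact ⟨isBinaryOperation_removeCut A π τ ⟨hπ, hτ⟩, isBinaryOperation_removeCut A π' τ' ⟨hπ', hτ'⟩,
    fun hi => fragment_removeCut_eq hτ hi.ne' (hfragπ hi) (hfragτ hi)⟩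

theorem nonPollutive_removeCut (A : Formula) : NonPollutive (removeCut A) := by
  rintro s i π τ ⟨hπ, hcutπ⟩ ⟨hτ, hcutτ⟩
  refine ⟨isBinaryOperation_removeCut A π τ ⟨hπ, hτ⟩, fun hi w hw => ?_⟩
  exact (allowed_removeCut (M := ⟨True, False⟩) hτ hi.ne'
    (fun w hw => ⟨fun _ => hcutπ hi w hw, False.elim⟩)
    (fun w hw => ⟨fun _ => hcutτ hi w hw, False.elim⟩) hw).noCut trivial

theorem nonFattening_removeCut (A : Formula) : NonFattening (removeCut A) := by
  rintro s i π τ ⟨hπ, hslimπ⟩ ⟨hτ, hslimτ⟩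
  refine ⟨isBinaryOperation_removeCut A π τ ⟨hπ, hτ⟩, fun hi w hw => ?_⟩
  exact (allowed_removeCut (M := ⟨False, True⟩) hτ hi.ne'
    (fun w hw => ⟨False.elim, fun _ => hslimπ hi w hw⟩)
    (fun w hw => ⟨False.elim, fun _ => hslimτ hi w hw⟩) hw).slim trivial

end Operation

theorem mainTheorem2 (A : Formula) :
    ∃ re : InfProof → InfProof → InfProof,
      IsRemoving A re ∧ NonExpansive re ∧ NonPollutive re ∧ NonFattening re := by
  exact ⟨removeCut A, isRemoving_removeCut A, nonExpansive_removeCut A, nonPollutive_removeCut A,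
    nonFattening_removeCut A⟩
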